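/- **Conventions.** All functions are real and $2\pi$-periodic; $\|g\|_s=\left(\int_{-\pi}^{\pi}|g(t)|^s\,dt\right)^{1/s}$ for $1\le s<\infty$, $\|g\|_\infty=\operatorname{ess\,sup}|g|$, $L_s$ is the space of measurable $g$ with $\|g\|_s<\infty$, $C$ is the space of continuous functions with $\|g\|_C=\max|g|$. For $m\ge 1$ let $E_m(g)_{L_s}=\inf_t\|g-t\|_s$, the infimum being over the trigonometric polynomials $t(x)=\sum_{k=0}^{m-1}(\alpha_k\cos kx+\gamma_k\sin kx)$. Let $\psi\in\mathcal D_0$, i.e. $\psi(k)>0$ for $k\in\mathbb N=\{1,2,\dots\}$ and $\lim_{k\to\infty}\psi(k+1)/\psi(k)=0$, and let $\bar\beta=(\beta_k)_{k\in\mathbb N}$ be any real sequence. If $f\in L_1$ has Fourier coefficients $a_k,b_k$, its $(\psi,\bar\beta)$-derivative $f^\psi_{\bar\beta}$ is the function in $L_1$ (if it exists) with Fourier series $$\sum_{k=1}^\infty\frac1{\psi(k)}\Bigl(a_k\cos\bigl(kx+\tfrac{\beta_k\pi}2\bigr)+b_k\sin\bigl(kx+\tfrac{\beta_k\pi}2\bigr)\Bigr).$$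 $C^\psi_{\bar\beta}L_s$ is the set of $f\in C$ for which $f^\psi_{\bar\beta}$ exists and belongs to $L_s$. For $f\in C$, $1\le p\le n$ and $x_j=\frac{2j\pi}{2n-1}$ put $$a_k^{(n-1)}=\frac2{2n-1}\sum_{j=0}^{2n-2}f(x_j)\cos kx_j,\qquad b_k^{(n-1)}=\frac2{2n-1}\sum_{j=0}^{2n-2}f(x_j)\sin kx_j,$$ $$\tilde V_{n,p}(f;x)=\frac{a_0^{(n-1)}}2+\sum_{k=1}^{n-1}\lambda_k^{(n)}\bigl(a_k^{(n-1)}\cos kx+b_k^{(n-1)}\sin kx\bigr),$$ where $\lambda_k^{(n)}=1$ for $0\le k\le n-p$ and $\lambda_k^{(n)}=1-\frac{k-n+p}p$ for $n-p+1\le k\le n$, and let $\tilde\rho_{n,p}(f;x)=f(x)-\tilde V_{n,p}(f;x)$. Further, let $\tau_{n,p}(k)=1-\frac{n-k}p$ for $n-p+1\le k\le n-1$ and $\tau_{n,p}(k)=1$ for $k\ge n$. For $1\le s<\infty$ let $s'=\frac s{s-1}$ ($s'=\infty$ if $s=1$). **Theorem.** There is an absolute constant $K>0$ (independent of $\psi,\bar\beta,s,n,p,f,x$)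 such that for all $\psi\in\mathcal D_0$, all real sequences $\bar\beta$, all $1\le s<\infty$, all $n,p\in\mathbb N$ with $2\le p\le n$ and all $f\in C^\psi_{\bar\beta}L_s$ the series $\sum_{k\ge n-p+2}\psi(k)\tau_{n,p}(k)$ converges and the following holds. 1. For every $x\in\mathbb R$, $$|\tilde\rho_{n,p}(f;x)|\le\Bigl(\frac{\|\cos t\|_{s'}}{\pi p}\psi(n-p+1)+K\sum_{k=n-p+2}^\infty\psi(k)\tau_{n,p}(k)\Bigr)E_{n-p+1}(f^\psi_{\bar\beta})_{L_s}.$$ 2. For every point $x_0\in\mathbb R$ there is a function $F\in C^\psi_{\bar\beta}L_s$ (depending on $f,n,p,x_0$) with $E_{n-p+1}(F^\psi_{\bar\beta})_{L_s}=E_{n-p+1}(f^\psi_{\bar\beta})_{L_s}$ such that, for some real $\theta$ with $|\theta|\le K$, $$|\tilde\rho_{n,p}(F;x_0)|=\Bigl(\frac{\|\cos t\|_{s'}}{\pi p}\psi(n-p+1)+\theta\sum_{k=n-p+2}^\infty\psi(k)\tau_{n,p}(k)\Bigr)E_{n-p+1}(F^\psi_{\bar\beta})_{L_s},$$ and the same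 equality, with another $\theta\in[-K,K]$, holds for $\|\tilde\rho_{n,p}(F;\cdot)\|_C=\max_x|\tilde\rho_{n,p}(F;x)|$ in place of $|\tilde\rho_{n,p}(F;x_0)|$. In particular this holds as $n-p\to\infty$. -/

import Mathlib

open Real Filter Topology MeasureTheory
open scoped ENNReal

noncomputable section

namespace ValleePoussin

/-- Lebesgue measure on the period `(-π, π]`. -/
def periodMeasure : Measure ℝ := volume.restrict (Set.Ioc (-π) π)

/-- The norm `‖g‖_s` over a period (for `s < ∞` it is `(∫_{-π}^{π} |g|^s)^{1/s}`,
for `s = ∞` the essential supremum of `|g|`). -/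
def lsNorm (s : ℝ≥0∞) (g : ℝ → ℝ) : ℝ := (eLpNorm g s periodMeasure).toReal

/-- The space `L_s` of `2π`-periodic functions. -/
def MemLs (s : ℝ≥0∞) (g : ℝ → ℝ) : Prop :=
  Function.Periodic g (2 * π) ∧ MemLp g s periodMeasure

/-- The space `C` of continuous `2π`-periodic functions. -/
def MemC (f : ℝ → ℝ) : Prop := Continuous f ∧ Function.Periodic f (2 * π)

/-- The cosine Fourier coefficient `a_k(f)`. -/
def fourierA (f : ℝ → ℝ) (k : ℕ) : ℝ := (1 / π) * ∫ t in (-π)..π, f t * cos (k * t)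

/-- The sine Fourier coefficient `b_k(f)`. -/
def fourierB (f : ℝ → ℝ) (k : ℕ) : ℝ := (1 / π) * ∫ t in (-π)..π, f t * sin (k * t)

/-- The class `D₀`: `ψ(k) > 0` for `k ≥ 1` and `ψ(k+1)/ψ(k) → 0`. (The value `ψ 0` is not used.) -/
def ClassD0 (ψ : ℕ → ℝ) : Prop :=
  (∀ k, 1 ≤ k → 0 < ψ k) ∧ Tendsto (fun k => ψ (k + 1) / ψ k) atTop (𝓝 0)

/-- `φ` is a `(ψ, β)`-derivative of `f`: both are `2π`-periodic and summable, and the series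
`∑_{k ≥ 1} (1/ψ(k)) (a_k(f) cos(kx + β_k π/2) + b_k(f) sin(kx + β_k π/2))` is the Fourier series
of `φ`. By the addition formulas the coefficient of `cos kx` in this series is
`(a_k cos(β_k π/2) + b_k sin(β_k π/2)) / ψ(k)`, the one of `sin kx` is
`(b_k cos(β_k π/2) - a_k sin(β_k π/2)) / ψ(k)`, and there is no constant term. -/
structure IsPsiBetaDeriv (ψ β : ℕ → ℝ) (f φ : ℝ → ℝ) : Prop where
  memL1 : MemLs 1 f
  deriv_memL1 : MemLs 1 φ
  const_coeff : fourierA φ 0 = 0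
  cos_coeff : ∀ k, 1 ≤ k → fourierA φ k =
    (1 / ψ k) * (fourierA f k * cos (β k * π / 2) + fourierB f k * sin (β k * π / 2))
  sin_coeff : ∀ k, 1 ≤ k → fourierB φ k =
    (1 / ψ k) * (fourierB f k * cos (β k * π / 2) - fourierA f k * sin (β k * π / 2))

/-- `f` belongs to `C^ψ_β L_s` and `φ` is its `(ψ, β)`-derivative (determined almost
everywhere by `f`). -/
def MemCPsiBetaLs (ψ β : ℕ → ℝ) (s : ℝ≥0∞) (f φ : ℝ → ℝ) : Prop :=
  MemC f ∧ IsPsiBetaDeriv ψ β f φ ∧ MemLs s φ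

/-- The trigonometric polynomial `∑_{k=0}^{m-1} (α_k cos kx + γ_k sin kx)`. -/
def trigPoly (m : ℕ) (α γ : ℕ → ℝ) (x : ℝ) : ℝ :=
  ∑ k ∈ Finset.range m, (α k * cos (k * x) + γ k * sin (k * x))

/-- The best approximation `E_m(g)_{L_s}` by trigonometric polynomials of order at most `m - 1`. -/
def bestApprox (m : ℕ) (s : ℝ≥0∞) (g : ℝ → ℝ) : ℝ :=
  sInf {r : ℝ | ∃ α γ : ℕ → ℝ, r = lsNorm s (fun x => g x - trigPoly m α γ x)}

/-- The interpolation node `x_j = 2jπ / (2n - 1)`. -/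
def node (n j : ℕ) : ℝ := 2 * j * π / (2 * n - 1)

/-- `a_k^{(n-1)} = 2/(2n-1) ∑_{j=0}^{2n-2} f(x_j) cos(k x_j)`. -/
def interpA (f : ℝ → ℝ) (n k : ℕ) : ℝ :=
  (2 / (2 * n - 1)) * ∑ j ∈ Finset.range (2 * n - 1), f (node n j) * cos (k * node n j)

/-- `b_k^{(n-1)} = 2/(2n-1) ∑_{j=0}^{2n-2} f(x_j) sin(k x_j)`. -/
def interpB (f : ℝ → ℝ) (n k : ℕ) : ℝ :=
  (2 / (2 * n - 1)) * ∑ j ∈ Finset.range (2 * n - 1), f (node n j) * sin (k * node n j)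

/-- The multipliers `λ_k^{(n)}`: `1` for `k ≤ n - p`, and `1 - (k - n + p)/p` for larger `k`. -/
def lam (n p k : ℕ) : ℝ := if k + p ≤ n then 1 else 1 - ((k : ℝ) - n + p) / p

/-- The interpolation analogue `Ṽ_{n,p}(f; x)` of the de la Vallée Poussin sum. -/
def interpVP (n p : ℕ) (f : ℝ → ℝ) (x : ℝ) : ℝ :=
  interpA f n 0 / 2 * lam n p 0 +
    ∑ k ∈ Finset.Icc 1 (n - 1),
      lam n p k * (interpA f n k * cos (k * x) + interpB f n k * sin (k * x))

/-- The deviation `ρ̃_{n,p}(f; x) = f(x) - Ṽ_{n,p}(f; x)`. -/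
def rhoTilde (n p : ℕ) (f : ℝ → ℝ) (x : ℝ) : ℝ := f x - interpVP n p f x

/-- `τ_{n,p}(k)`: `1 - (n - k)/p` for `n - p + 1 ≤ k ≤ n - 1`, and `1` for `k ≥ n`
(only indices `k ≥ n - p + 1` are used). -/
def tau (n p k : ℕ) : ℝ := if k < n then 1 - ((n : ℝ) - k) / p else 1

/-- The terms of `∑_{k ≥ n-p+2} ψ(k) τ_{n,p}(k)`, indexed by `i = k - (n-p+2) ≥ 0`. -/
def tailTerm (ψ : ℕ → ℝ) (n p i : ℕ) : ℝ := ψ (n - p + 2 + i) * tau n p (n - p + 2 + i)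

/-- The conjugate exponent `s' = s/(s-1)`; in `ℝ≥0∞` this is `∞` for `s = 1`. -/
def conjExp (s : ℝ≥0∞) : ℝ≥0∞ := s / (s - 1)

/-- The factor `‖cos t‖_{s'} ψ(n-p+1) / (πp) + θ ∑_{k ≥ n-p+2} ψ(k) τ_{n,p}(k)`. -/
def lebesgueFactor (ψ : ℕ → ℝ) (s : ℝ≥0∞) (n p : ℕ) (θ : ℝ) : ℝ :=
  lsNorm (conjExp s) cos / (π * p) * ψ (n - p + 1) + θ * ∑' i, tailTerm ψ n p i

end ValleePoussin

end

/-! Write `m = n - p + 1`, `E = E_m(φ)` and `W = ∑ ψ(k) τ(k)` over `k ≥ m + 1`. Since `ψ` is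
summable and the Fourier coefficients of `φ` are bounded, the Fourier series of `f` converges
absolutely. The deviation is a finite linear combination of point values, so it may be computed
harmonic by harmonic.

Constants and harmonics of order below `m` are reproduced exactly. Orders `m ≤ k < n` are multiplied
by `1 - λ_k = τ(k)`. Orders `k ≥ n` are aliased to low frequencies at the `2n - 1` nodes, which
costs only an absolute factor. The order `m`, where `τ = 1/p`, contributes `ψ(m)/(πp) ∫ φ(t) cos(mt
+ c) dt` with `c = β_m π/2 - m x`. Coefficients of order `k ≥ m` do not change when a polynomial of
order below `m` is subtracted from `φ`, so they are at most `2E`; hence all remaining terms together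
are at most `32 W E` (`abs_rhoTilde_sub_le`).

The upper bound is then Hölder's inequality for the main term
(`abs_integral_mul_cos_le_bestApprox`). For sharpness, take a function `h` nearly extremal for
Hölder against `cos` (`exists_nearly_extremal_cos`) and form `h(mt + c)`, with `c` chosen for `x₀`.
Subtracting its mean and rescaling gives best approximation exactly `E`
(`exists_nearly_extremal_deriv`). It need not be known that zero is its best approximant: `E_m(h(m·
+ c)) ≤ ‖h‖_s` already makes the ratio of integral to best approximation large enough. Integrating
this function in the `(ψ, β)` sense gives `F`. The lower bound at `x₀` and the uniform upper bound
together also settle the maximum norm. -/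

noncomputable section

namespace ValleePoussin

/-! ### Interpolation of the trigonometric monomials -/

/-- The harmonic `C cos kx + D sin kx`. -/
def harmonic (C D : ℝ) (k : ℕ) (x : ℝ) : ℝ := C * cos (k * x) + D * sin (k * x)

/-- The terms are powers of a single `(2n-1)`-th root of unity, so this is a geometric sum; the root
equals `1` exactly when `2n - 1` divides `i`. -/
theorem sum_exp_node (n : ℕ) (hn : 1 ≤ n) (i : ℤ) :
    ∑ j ∈ Finset.range (2 * n - 1), Complex.exp ((i * node n j : ℝ) * Complex.I) =
      if ((2 * n - 1 : ℕ) : ℤ) ∣ i then ((2 * n - 1 : ℕ) : ℂ) else 0 := by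
  obtain ⟨N, hN⟩ : ∃ N : ℕ, N = 2 * n - 1 := ⟨_, rfl⟩
  have hNR : (2 * (n : ℝ) - 1) = N := by
    rw [hN, Nat.cast_sub (by omega)]; push_cast; ring
  have hN0 : (N : ℂ) ≠ 0 := by
    have : N ≠ 0 := by omega
    exact_mod_cast this
  rw [← hN]
  set z : ℂ := Complex.exp (2 * π * Complex.I * (i / N)) with hz
  have hterm : ∀ j : ℕ, Complex.exp ((i * node n j : ℝ) * Complex.I) = z ^ j := by
    intro j
    rw [hz, ← Complex.exp_nat_mul, node, hNR]
    congr 1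
    push_cast
    field_simp
  simp only [hterm]
  have hzN : z ^ N = 1 := by
    rw [hz, ← Complex.exp_nat_mul, Complex.exp_eq_one_iff]
    exact ⟨i, by field_simp⟩
  split_ifs with h
  · obtain ⟨q, rfl⟩ := h
    have : z = 1 := by
      rw [hz, Complex.exp_eq_one_iff]
      exact ⟨q, by push_cast; field_simp⟩
    simp [this]
  · have hz1 : z ≠ 1 := by
      rw [hz, Ne, Complex.exp_eq_one_iff]
      rintro ⟨q, hq⟩
      apply h
      refine ⟨q, ?_⟩
      have h2 : (2 * π * Complex.I : ℂ) ≠ 0 := by simp [pi_ne_zero]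
      rw [mul_comm (q : ℂ)] at hq
      have h3 := mul_left_cancel₀ h2 hq
      rw [div_eq_iff hN0] at h3
      have : (i : ℂ) = ((N * q : ℤ) : ℂ) := by rw [h3]; push_cast; ring
      exact_mod_cast this
    rw [geom_sum_eq hz1, hzN]; simp

theorem sum_cos_node (n : ℕ) (hn : 1 ≤ n) (i : ℤ) :
    ∑ j ∈ Finset.range (2 * n - 1), cos (i * node n j) =
      if ((2 * n - 1 : ℕ) : ℤ) ∣ i then ((2 * n - 1 : ℕ) : ℝ) else 0 := by
  have h := congrArg Complex.re (sum_exp_node n hn i)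
  rw [Complex.re_sum] at h
  simp only [Complex.exp_ofReal_mul_I_re] at h
  rw [h]; split_ifs <;> simp

theorem sum_sin_node (n : ℕ) (hn : 1 ≤ n) (i : ℤ) :
    ∑ j ∈ Finset.range (2 * n - 1), sin (i * node n j) = 0 := by
  have h := congrArg Complex.im (sum_exp_node n hn i)
  rw [Complex.im_sum] at h
  simp only [Complex.exp_ofReal_mul_I_im] at h
  rw [h]; split_ifs <;> simp

/-- `1` if `2n - 1` divides `i`, and `0` otherwise. -/
def aliasInd (n : ℕ) (i : ℤ) : ℝ := if ((2 * n - 1 : ℕ) : ℤ) ∣ i then 1 else 0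

theorem mean_cos_node (n : ℕ) (hn : 1 ≤ n) (i : ℤ) :
    (1 / (2 * n - 1)) * ∑ j ∈ Finset.range (2 * n - 1), cos (i * node n j) = aliasInd n i := by
  have hNR : (2 * (n : ℝ) - 1) = ((2 * n - 1 : ℕ) : ℝ) := by
    rw [Nat.cast_sub (by omega)]; push_cast; ring
  have h0 : ((2 * n - 1 : ℕ) : ℝ) ≠ 0 := by
    have : 2 * n - 1 ≠ 0 := by omega
    exact_mod_cast this
  rw [sum_cos_node n hn, aliasInd, hNR]
  split_ifs
  · field_simp
  · simp

theorem interpA_cos (n : ℕ) (hn : 1 ≤ n) (k l : ℕ) :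
    interpA (fun x => cos (k * x)) n l = aliasInd n ((k : ℤ) - l) + aliasInd n ((k : ℤ) + l) := by
  rw [← mean_cos_node n hn, ← mean_cos_node n hn, interpA, ← mul_add, ← Finset.sum_add_distrib,
    Finset.mul_sum, Finset.mul_sum]
  refine Finset.sum_congr rfl fun j _ => ?_
  push_cast
  rw [sub_mul, add_mul, cos_sub, cos_add]
  ring

theorem interpB_sin (n : ℕ) (hn : 1 ≤ n) (k l : ℕ) :
    interpB (fun x => sin (k * x)) n l = aliasInd n ((k : ℤ) - l) - aliasInd n ((k : ℤ) + l) := by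
  rw [← mean_cos_node n hn, ← mean_cos_node n hn, interpB, ← mul_sub, ← Finset.sum_sub_distrib,
    Finset.mul_sum, Finset.mul_sum]
  refine Finset.sum_congr rfl fun j _ => ?_
  push_cast
  rw [sub_mul, add_mul, cos_sub, cos_add]
  ring

theorem sum_sin_mul_cos_node (n : ℕ) (hn : 1 ≤ n) (k l : ℕ) :
    ∑ j ∈ Finset.range (2 * n - 1), sin (k * node n j) * cos (l * node n j) = 0 := by
  have h1 := sum_sin_node n hn ((k : ℤ) - l)
  have h2 := sum_sin_node n hn ((k : ℤ) + l)
  have h3 : ∑ j ∈ Finset.range (2 * n - 1), sin (k * node n j) * cos (l * node n j) =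
      ((∑ j ∈ Finset.range (2 * n - 1), sin (((k : ℤ) - l : ℤ) * node n j)) +
      ∑ j ∈ Finset.range (2 * n - 1), sin (((k : ℤ) + l : ℤ) * node n j)) / 2 := by
    rw [← Finset.sum_add_distrib, Finset.sum_div]
    refine Finset.sum_congr rfl fun j _ => ?_
    push_cast
    rw [sub_mul, add_mul, sin_sub, sin_add]
    ring
  rw [h3, h1, h2]; simp

theorem interpA_sin (n : ℕ) (hn : 1 ≤ n) (k l : ℕ) :
    interpA (fun x => sin (k * x)) n l = 0 := by
  rw [interpA, sum_sin_mul_cos_node n hn, mul_zero]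

theorem interpB_cos (n : ℕ) (hn : 1 ≤ n) (k l : ℕ) :
    interpB (fun x => cos (k * x)) n l = 0 := by
  have := sum_sin_mul_cos_node n hn l k
  rw [interpB]
  simp only [mul_comm (cos _) (sin _)]
  rw [this, mul_zero]

/-! ### Aliasing of a single frequency. -/

theorem interpVP_cos (n p : ℕ) (hn : 1 ≤ n) (hp : p ≤ n) (k : ℕ) (x : ℝ) :
    interpVP n p (fun x => cos (k * x)) x = aliasInd n k +
      ∑ l ∈ Finset.Icc 1 (n - 1),
        (aliasInd n ((k : ℤ) - l) + aliasInd n ((k : ℤ) + l)) * (lam n p l * cos (l * x)) := by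
  simp only [interpVP, interpA_cos n hn, interpB_cos n hn]
  congr 1
  · simp [lam, hp]
  · exact Finset.sum_congr rfl fun l _ => by ring

theorem interpVP_sin (n p : ℕ) (hn : 1 ≤ n) (k : ℕ) (x : ℝ) :
    interpVP n p (fun x => sin (k * x)) x =
      ∑ l ∈ Finset.Icc 1 (n - 1),
        (aliasInd n ((k : ℤ) - l) - aliasInd n ((k : ℤ) + l)) * (lam n p l * sin (l * x)) := by
  simp only [interpVP, interpA_sin n hn, interpB_sin n hn]
  simp only [zero_div, zero_mul, zero_add]
  exact Finset.sum_congr rfl fun l _ => by ring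

theorem aliasInd_nonneg (n : ℕ) (i : ℤ) : 0 ≤ aliasInd n i := by
  unfold aliasInd; split_ifs <;> simp

theorem aliasInd_le_one (n : ℕ) (i : ℤ) : aliasInd n i ≤ 1 := by
  unfold aliasInd; split_ifs <;> simp

theorem aliasInd_of_small (n : ℕ) (i : ℤ) (hi : |i| < 2 * n - 1) :
    aliasInd n i = if i = 0 then 1 else 0 := by
  unfold aliasInd
  congr 1
  refine propext ⟨fun h => ?_, fun h => h ▸ dvd_zero _⟩
  exact Int.eq_zero_of_abs_lt_dvd h (by omega)

/-- Two indices in `[1, n-1]` congruent modulo `2n - 1` coincide, so at most one term is nonzero. -/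
theorem sum_aliasInd_sub_le (n k : ℕ) :
    ∑ l ∈ Finset.Icc 1 (n - 1), aliasInd n ((k : ℤ) - l) ≤ 1 := by
  simp only [aliasInd]
  rw [Finset.sum_boole]
  have : (Finset.filter (fun l : ℕ => ((2 * n - 1 : ℕ) : ℤ) ∣ (k : ℤ) - l)
      (Finset.Icc 1 (n - 1))).card ≤ 1 := by
    rw [Finset.card_le_one]
    intro a ha b hb
    simp only [Finset.mem_filter, Finset.mem_Icc] at ha hb
    have h := dvd_sub ha.2 hb.2
    have := Int.eq_zero_of_abs_lt_dvd h (by rw [abs_lt]; omega)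
    omega
  exact_mod_cast this

theorem sum_aliasInd_add_le (n k : ℕ) :
    ∑ l ∈ Finset.Icc 1 (n - 1), aliasInd n ((k : ℤ) + l) ≤ 1 := by
  simp only [aliasInd]
  rw [Finset.sum_boole]
  have : (Finset.filter (fun l : ℕ => ((2 * n - 1 : ℕ) : ℤ) ∣ (k : ℤ) + l)
      (Finset.Icc 1 (n - 1))).card ≤ 1 := by
    rw [Finset.card_le_one]
    intro a ha b hb
    simp only [Finset.mem_filter, Finset.mem_Icc] at ha hb
    have h := dvd_sub ha.2 hb.2
    have := Int.eq_zero_of_abs_lt_dvd h (by rw [abs_lt]; omega)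
    omega
  exact_mod_cast this

theorem lam_mem (n p l : ℕ) (hp : 1 ≤ p) (hl : l ≤ n) : 0 ≤ lam n p l ∧ lam n p l ≤ 1 := by
  unfold lam
  have hp' : (0 : ℝ) < p := by exact_mod_cast hp
  split_ifs with h
  · simp
  · have h1 : (n : ℝ) < l + p := by exact_mod_cast (not_le.mp h)
    have h2 : (l : ℝ) ≤ n := by exact_mod_cast hl
    constructor
    · rw [sub_nonneg, div_le_one hp']; linarith
    · have : 0 ≤ ((l : ℝ) - n + p) / p := by apply div_nonneg <;> linarith
      linarith

theorem abs_lam_mul_le (n p l : ℕ) (hp : 1 ≤ p) (hl : l ≤ n) (y : ℝ) (hy : |y| ≤ 1) :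
    |lam n p l * y| ≤ 1 := by
  obtain ⟨h0, h1⟩ := lam_mem n p l hp hl
  rw [abs_mul, abs_of_nonneg h0]
  exact mul_le_one₀ h1 (abs_nonneg _) hy

/-- The bound is `1` for the constant term plus `1` for each of the two alias sums, since all
multipliers lie in `[0, 1]`. -/
theorem abs_interpVP_cos_le (n p : ℕ) (hp1 : 1 ≤ p) (hp : p ≤ n) (k : ℕ) (x : ℝ) :
    |interpVP n p (fun x => cos (k * x)) x| ≤ 3 := by
  rw [interpVP_cos n p (by omega) hp]
  have h1 := sum_aliasInd_sub_le n k
  have h2 := sum_aliasInd_add_le n k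
  have h3 : |∑ l ∈ Finset.Icc 1 (n - 1),
        (aliasInd n ((k : ℤ) - l) + aliasInd n ((k : ℤ) + l)) * (lam n p l * cos (l * x))| ≤
      ∑ l ∈ Finset.Icc 1 (n - 1), (aliasInd n ((k : ℤ) - l) + aliasInd n ((k : ℤ) + l)) := by
    refine (Finset.abs_sum_le_sum_abs _ _).trans (Finset.sum_le_sum fun l hl => ?_)
    rw [Finset.mem_Icc] at hl
    have hnn := add_nonneg (aliasInd_nonneg n ((k : ℤ) - l)) (aliasInd_nonneg n ((k : ℤ) + l))
    rw [abs_mul, abs_of_nonneg hnn]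
    exact mul_le_of_le_one_right hnn (abs_lam_mul_le n p l hp1 (by omega) _ (abs_cos_le_one _))
  rw [Finset.sum_add_distrib] at h3
  refine (abs_add_le _ _).trans ?_
  rw [abs_of_nonneg (aliasInd_nonneg n k)]
  linarith [aliasInd_le_one n k]

theorem abs_interpVP_sin_le (n p : ℕ) (hp1 : 1 ≤ p) (hp : p ≤ n) (k : ℕ) (x : ℝ) :
    |interpVP n p (fun x => sin (k * x)) x| ≤ 3 := by
  rw [interpVP_sin n p (by omega)]
  have h1 := sum_aliasInd_sub_le n k
  have h2 := sum_aliasInd_add_le n k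
  have h3 : |∑ l ∈ Finset.Icc 1 (n - 1),
        (aliasInd n ((k : ℤ) - l) - aliasInd n ((k : ℤ) + l)) * (lam n p l * sin (l * x))| ≤
      ∑ l ∈ Finset.Icc 1 (n - 1), (aliasInd n ((k : ℤ) - l) + aliasInd n ((k : ℤ) + l)) := by
    refine (Finset.abs_sum_le_sum_abs _ _).trans (Finset.sum_le_sum fun l hl => ?_)
    rw [Finset.mem_Icc] at hl
    have ha := aliasInd_nonneg n ((k : ℤ) - l)
    have hb := aliasInd_nonneg n ((k : ℤ) + l)
    rw [abs_mul]
    refine (mul_le_of_le_one_right (abs_nonneg _)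
      (abs_lam_mul_le n p l hp1 (by omega) _ (abs_sin_le_one _))).trans ?_
    rw [abs_le]; constructor <;> linarith
  rw [Finset.sum_add_distrib] at h3
  linarith

/-- For `k, l ≤ n - 1` one has `|k ± l| < 2n - 1`, so no aliasing occurs and only `l = k` survives.
-/
theorem interpVP_cos_of_lt (n p : ℕ) (hp : p ≤ n) (k : ℕ) (hk1 : 1 ≤ k) (hk : k < n) (x : ℝ) :
    interpVP n p (fun x => cos (k * x)) x = lam n p k * cos (k * x) := by
  rw [interpVP_cos n p (by omega) hp, aliasInd_of_small n k (by rw [abs_lt]; omega),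
    if_neg (by omega), zero_add, Finset.sum_eq_single k]
  · rw [aliasInd_of_small n _ (by rw [abs_lt]; omega), if_pos (by omega),
      aliasInd_of_small n _ (by rw [abs_lt]; omega), if_neg (by omega)]
    ring
  · intro l hl hlk
    rw [Finset.mem_Icc] at hl
    rw [aliasInd_of_small n _ (by rw [abs_lt]; omega), if_neg (by omega),
      aliasInd_of_small n _ (by rw [abs_lt]; omega), if_neg (by omega)]
    ring
  · intro h
    rw [Finset.mem_Icc] at h
    omega

theorem interpVP_sin_of_lt (n p : ℕ) (k : ℕ) (hk1 : 1 ≤ k) (hk : k < n) (x : ℝ) :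
    interpVP n p (fun x => sin (k * x)) x = lam n p k * sin (k * x) := by
  rw [interpVP_sin n p (by omega), Finset.sum_eq_single k]
  · rw [aliasInd_of_small n _ (by rw [abs_lt]; omega), if_pos (by omega),
      aliasInd_of_small n _ (by rw [abs_lt]; omega), if_neg (by omega)]
    ring
  · intro l hl hlk
    rw [Finset.mem_Icc] at hl
    rw [aliasInd_of_small n _ (by rw [abs_lt]; omega), if_neg (by omega),
      aliasInd_of_small n _ (by rw [abs_lt]; omega), if_neg (by omega)]
    ring
  · intro h
    rw [Finset.mem_Icc] at h
    omega

theorem interpVP_linear (n p : ℕ) (f g : ℝ → ℝ) (c d : ℝ) (x : ℝ) :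
    interpVP n p (fun y => c * f y + d * g y) x = c * interpVP n p f x + d * interpVP n p g x := by
  have hA : ∀ k, interpA (fun y => c * f y + d * g y) n k = c * interpA f n k + d * interpA g n k := by
    intro k
    simp only [interpA, add_mul, Finset.sum_add_distrib, mul_assoc, ← Finset.mul_sum]
    ring
  have hB : ∀ k, interpB (fun y => c * f y + d * g y) n k = c * interpB f n k + d * interpB g n k := by
    intro k
    simp only [interpB, add_mul, Finset.sum_add_distrib, mul_assoc, ← Finset.mul_sum]
    ring
  simp only [interpVP, hA, hB]
  rw [mul_add, mul_add, Finset.mul_sum, Finset.mul_sum, add_add_add_comm, ← Finset.sum_add_distrib]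
  congr 1
  · ring
  · exact Finset.sum_congr rfl fun k _ => by ring

/-! ### The deviation on constants and single harmonics, and its continuity properties. -/

theorem rhoTilde_linear (n p : ℕ) (f g : ℝ → ℝ) (c d : ℝ) (x : ℝ) :
    rhoTilde n p (fun y => c * f y + d * g y) x = c * rhoTilde n p f x + d * rhoTilde n p g x := by
  simp only [rhoTilde, interpVP_linear]; ring

theorem rhoTilde_one (n p : ℕ) (hn : 1 ≤ n) (hp : p ≤ n) (x : ℝ) :
    rhoTilde n p (fun _ => 1) x = 0 := by
  have h := interpVP_cos n p hn hp 0 x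
  simp only [Nat.cast_zero, zero_mul, cos_zero] at h
  rw [rhoTilde, h, Finset.sum_eq_zero]
  · rw [aliasInd_of_small n 0 (by simp; omega)]; simp
  · intro l hl
    rw [Finset.mem_Icc] at hl
    rw [aliasInd_of_small n _ (by rw [abs_lt]; omega), if_neg (by omega),
      aliasInd_of_small n _ (by rw [abs_lt]; omega), if_neg (by omega)]
    ring

theorem one_sub_lam_of_le (n p k : ℕ) (hk : k + p ≤ n) : 1 - lam n p k = 0 := by
  simp [lam, hk]

theorem one_sub_lam_of_lt (n p k : ℕ) (hp : 1 ≤ p) (hk : n < k + p) (hk' : k < n) :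
    1 - lam n p k = tau n p k := by
  have hp' : (p : ℝ) ≠ 0 := by
    have : p ≠ 0 := by omega
    exact_mod_cast this
  rw [lam, if_neg (by omega), tau, if_pos hk']
  field_simp
  ring

theorem rhoTilde_harmonic (n p : ℕ) (C D : ℝ) (k : ℕ) (x : ℝ) :
    rhoTilde n p (harmonic C D k) x =
      C * rhoTilde n p (fun x => cos (k * x)) x + D * rhoTilde n p (fun x => sin (k * x)) x :=
  rhoTilde_linear n p _ _ C D x

theorem rhoTilde_harmonic_of_lt (n p : ℕ) (hp : p ≤ n) (C D : ℝ) (k : ℕ) (hk1 : 1 ≤ k)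
    (hk : k < n) (x : ℝ) :
    rhoTilde n p (harmonic C D k) x = (1 - lam n p k) * harmonic C D k x := by
  rw [rhoTilde_harmonic, rhoTilde, rhoTilde, interpVP_cos_of_lt n p hp k hk1 hk,
    interpVP_sin_of_lt n p k hk1 hk, harmonic]
  ring

theorem abs_harmonic_le (C D : ℝ) (k : ℕ) (x : ℝ) : |harmonic C D k x| ≤ |C| + |D| := by
  refine (abs_add_le _ _).trans (add_le_add ?_ ?_) <;> rw [abs_mul]
  · exact mul_le_of_le_one_right (abs_nonneg _) (abs_cos_le_one _)
  · exact mul_le_of_le_one_right (abs_nonneg _) (abs_sin_le_one _)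

theorem tau_nonneg (n p k : ℕ) (hp : 1 ≤ p) (hk : n ≤ k + p) : 0 ≤ tau n p k := by
  unfold tau
  have hp' : (0 : ℝ) < p := by exact_mod_cast hp
  have h1 : (n : ℝ) ≤ k + p := by exact_mod_cast hk
  split_ifs
  · rw [sub_nonneg, div_le_one hp']; linarith
  · simp

theorem tau_le_one (n p k : ℕ) : tau n p k ≤ 1 := by
  unfold tau
  split_ifs with h
  · have : (k : ℝ) ≤ n := by exact_mod_cast h.le
    have : 0 ≤ ((n : ℝ) - k) / p := div_nonneg (by linarith) (by positivity)
    linarith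
  · simp

/-- Below order `n` the deviation is exactly `τ(k)` times the harmonic. From order `n` on `τ = 1`,
and `4 = 1 + 3` adds the monomial to its aliased image. -/
theorem abs_rhoTilde_harmonic_le (n p : ℕ) (hp1 : 1 ≤ p) (hp : p ≤ n) (C D : ℝ) (k : ℕ)
    (hk1 : 1 ≤ k) (hk : n < k + p) (x : ℝ) :
    |rhoTilde n p (harmonic C D k) x| ≤ 4 * tau n p k * (|C| + |D|) := by
  rcases lt_or_ge k n with h | h
  · rw [rhoTilde_harmonic_of_lt n p hp C D k hk1 h, one_sub_lam_of_lt n p k hp1 hk h, abs_mul,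
      abs_of_nonneg (tau_nonneg n p k hp1 hk.le)]
    have h1 := tau_nonneg n p k hp1 hk.le
    have h2 := mul_le_mul_of_nonneg_left (abs_harmonic_le C D k x) h1
    have h3 : 0 ≤ tau n p k * (|C| + |D|) := by positivity
    linarith
  · rw [tau, if_neg (by omega), rhoTilde_harmonic]
    have hc : |rhoTilde n p (fun x => cos (k * x)) x| ≤ 4 := by
      refine (abs_sub _ _).trans ?_
      linarith [abs_interpVP_cos_le n p hp1 hp k x, abs_cos_le_one (k * x)]
    have hs : |rhoTilde n p (fun x => sin (k * x)) x| ≤ 4 := by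
      refine (abs_sub _ _).trans ?_
      linarith [abs_interpVP_sin_le n p hp1 hp k x, abs_sin_le_one (k * x)]
    refine (abs_add_le _ _).trans ?_
    rw [abs_mul, abs_mul]
    linarith [mul_le_mul_of_nonneg_left hc (abs_nonneg C),
      mul_le_mul_of_nonneg_left hs (abs_nonneg D)]

/-- Only finitely many point values enter the deviation, so pointwise convergence is enough. -/
theorem hasSum_rhoTilde {ι : Type*} (n p : ℕ) (g : ι → ℝ → ℝ) (f : ℝ → ℝ)
    (h : ∀ y, HasSum (fun i => g i y) (f y)) (x : ℝ) :
    HasSum (fun i => rhoTilde n p (g i) x) (rhoTilde n p f x) := by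
  have hA : ∀ k, HasSum (fun i => interpA (g i) n k) (interpA f n k) := fun k =>
    (hasSum_sum fun j _ => (h (node n j)).mul_right _).mul_left _
  have hB : ∀ k, HasSum (fun i => interpB (g i) n k) (interpB f n k) := fun k =>
    (hasSum_sum fun j _ => (h (node n j)).mul_right _).mul_left _
  exact (h x).sub ((((hA 0).div_const 2).mul_right _).add
    (hasSum_sum fun k _ => (((hA k).mul_right _).add ((hB k).mul_right _)).mul_left _))

theorem continuous_rhoTilde (n p : ℕ) (f : ℝ → ℝ) (hf : Continuous f) :
    Continuous (rhoTilde n p f) := by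
  unfold rhoTilde interpVP; fun_prop

theorem periodic_rhoTilde (n p : ℕ) (f : ℝ → ℝ) (hf : Function.Periodic f (2 * π)) :
    Function.Periodic (rhoTilde n p f) (2 * π) := by
  intro x
  have hc : ∀ k : ℕ, cos (k * (x + 2 * π)) = cos (k * x) := fun k => by
    rw [mul_add]; exact cos_add_nat_mul_two_pi _ k
  have hs : ∀ k : ℕ, sin (k * (x + 2 * π)) = sin (k * x) := fun k => by
    rw [mul_add]; exact sin_add_nat_mul_two_pi _ k
  simp only [rhoTilde, interpVP, hc, hs, hf x]

/-! ### Fourier coefficients -/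

theorem integral_cos_int_mul (j : ℤ) :
    ∫ t in (-π)..π, cos (j * t) = if j = 0 then 2 * π else 0 := by
  split_ifs with h
  · simp [h]; ring
  · have hj : (j : ℝ) ≠ 0 := by exact_mod_cast h
    rw [intervalIntegral.integral_comp_mul_left (fun t => cos t) hj, integral_cos, mul_neg, sin_neg,
      sin_int_mul_pi]
    simp

theorem integral_sin_int_mul (j : ℤ) : ∫ t in (-π)..π, sin (j * t) = 0 := by
  by_cases h : j = 0
  · simp [h]
  · have hj : (j : ℝ) ≠ 0 := by exact_mod_cast h
    rw [intervalIntegral.integral_comp_mul_left (fun t => sin t) hj, integral_sin, mul_neg, cos_neg]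
    simp

theorem intervalIntegrable_mul_cos {f : ℝ → ℝ} (hf : IntervalIntegrable f volume (-π) π) (k : ℝ) :
    IntervalIntegrable (fun t => f t * cos (k * t)) volume (-π) π :=
  hf.mul_continuousOn (by fun_prop)

theorem intervalIntegrable_mul_sin {f : ℝ → ℝ} (hf : IntervalIntegrable f volume (-π) π) (k : ℝ) :
    IntervalIntegrable (fun t => f t * sin (k * t)) volume (-π) π :=
  hf.mul_continuousOn (by fun_prop)

theorem fourierA_linear {f g : ℝ → ℝ} (hf : IntervalIntegrable f volume (-π) π)
    (hg : IntervalIntegrable g volume (-π) π) (c d : ℝ) (k : ℕ) :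
    fourierA (fun t => c * f t + d * g t) k = c * fourierA f k + d * fourierA g k := by
  simp only [fourierA, add_mul, mul_assoc]
  rw [intervalIntegral.integral_add ((intervalIntegrable_mul_cos hf k).const_mul c)
    ((intervalIntegrable_mul_cos hg k).const_mul d), intervalIntegral.integral_const_mul,
    intervalIntegral.integral_const_mul]
  ring

theorem fourierB_linear {f g : ℝ → ℝ} (hf : IntervalIntegrable f volume (-π) π)
    (hg : IntervalIntegrable g volume (-π) π) (c d : ℝ) (k : ℕ) :
    fourierB (fun t => c * f t + d * g t) k = c * fourierB f k + d * fourierB g k := by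
  simp only [fourierB, add_mul, mul_assoc]
  rw [intervalIntegral.integral_add ((intervalIntegrable_mul_sin hf k).const_mul c)
    ((intervalIntegrable_mul_sin hg k).const_mul d), intervalIntegral.integral_const_mul,
    intervalIntegral.integral_const_mul]
  ring

theorem fourierA_cos (l k : ℕ) (hk : 1 ≤ k) :
    fourierA (fun t => cos (l * t)) k = if l = k then 1 else 0 := by
  have h : ∀ t : ℝ, cos (l * t) * cos (k * t) =
      (1 / 2) * (cos (((l : ℤ) - k : ℤ) * t) + cos (((l : ℤ) + k : ℤ) * t)) := by
    intro t
    push_cast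
    rw [sub_mul, add_mul, cos_sub, cos_add]
    ring
  simp only [fourierA, h]
  rw [intervalIntegral.integral_const_mul, intervalIntegral.integral_add
    (Continuous.intervalIntegrable (by fun_prop) _ _)
    (Continuous.intervalIntegrable (by fun_prop) _ _), integral_cos_int_mul, integral_cos_int_mul]
  rw [if_neg (by omega : ¬ ((l : ℤ) + k = 0))]
  by_cases hlk : l = k
  · rw [if_pos (by omega), if_pos hlk]
    have := pi_ne_zero
    field_simp
    ring
  · rw [if_neg (by omega), if_neg hlk]
    simp

theorem fourierB_sin (l k : ℕ) (hk : 1 ≤ k) :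
    fourierB (fun t => sin (l * t)) k = if l = k then 1 else 0 := by
  have h : ∀ t : ℝ, sin (l * t) * sin (k * t) =
      (1 / 2) * (cos (((l : ℤ) - k : ℤ) * t) - cos (((l : ℤ) + k : ℤ) * t)) := by
    intro t
    push_cast
    rw [sub_mul, add_mul, cos_sub, cos_add]
    ring
  simp only [fourierB, h]
  rw [intervalIntegral.integral_const_mul, intervalIntegral.integral_sub
    (Continuous.intervalIntegrable (by fun_prop) _ _)
    (Continuous.intervalIntegrable (by fun_prop) _ _), integral_cos_int_mul, integral_cos_int_mul]
  rw [if_neg (by omega : ¬ ((l : ℤ) + k = 0))]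
  by_cases hlk : l = k
  · rw [if_pos (by omega), if_pos hlk]
    have := pi_ne_zero
    field_simp
    ring
  · rw [if_neg (by omega), if_neg hlk]
    simp

theorem integral_sin_mul_cos (l k : ℕ) : ∫ t in (-π)..π, sin (l * t) * cos (k * t) = 0 := by
  have h : ∀ t : ℝ, sin (l * t) * cos (k * t) =
      (1 / 2) * (sin (((l : ℤ) - k : ℤ) * t) + sin (((l : ℤ) + k : ℤ) * t)) := by
    intro t
    push_cast
    rw [sub_mul, add_mul, sin_sub, sin_add]
    ring
  simp only [h]
  rw [intervalIntegral.integral_const_mul, intervalIntegral.integral_add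
    (Continuous.intervalIntegrable (by fun_prop) _ _)
    (Continuous.intervalIntegrable (by fun_prop) _ _), integral_sin_int_mul, integral_sin_int_mul]
  simp

theorem fourierA_sin (l k : ℕ) : fourierA (fun t => sin (l * t)) k = 0 := by
  simp only [fourierA, integral_sin_mul_cos, mul_zero]

theorem fourierB_cos (l k : ℕ) : fourierB (fun t => cos (l * t)) k = 0 := by
  simp only [fourierB, mul_comm (cos _) (sin _), integral_sin_mul_cos, mul_zero]

theorem continuous_harmonic (C D : ℝ) (k : ℕ) : Continuous (harmonic C D k) := by
  unfold harmonic; fun_prop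

theorem periodic_harmonic (C D : ℝ) (k : ℕ) : Function.Periodic (harmonic C D k) (2 * π) := by
  intro x
  have hc : cos (k * (x + 2 * π)) = cos (k * x) := by
    rw [mul_add]; exact cos_add_nat_mul_two_pi _ k
  have hs : sin (k * (x + 2 * π)) = sin (k * x) := by
    rw [mul_add]; exact sin_add_nat_mul_two_pi _ k
  simp only [harmonic, hc, hs]

theorem fourierA_harmonic (C D : ℝ) (l k : ℕ) (hk : 1 ≤ k) :
    fourierA (harmonic C D l) k = if l = k then C else 0 := by
  have := fourierA_linear (f := fun t => cos (l * t)) (g := fun t => sin (l * t))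
    (Continuous.intervalIntegrable (by fun_prop) _ _)
    (Continuous.intervalIntegrable (by fun_prop) _ _) C D k
  rw [fourierA_cos l k hk, fourierA_sin] at this
  refine this.trans ?_
  split_ifs <;> simp

theorem fourierB_harmonic (C D : ℝ) (l k : ℕ) (hk : 1 ≤ k) :
    fourierB (harmonic C D l) k = if l = k then D else 0 := by
  have := fourierB_linear (f := fun t => cos (l * t)) (g := fun t => sin (l * t))
    (Continuous.intervalIntegrable (by fun_prop) _ _)
    (Continuous.intervalIntegrable (by fun_prop) _ _) C D k
  rw [fourierB_sin l k hk, fourierB_cos] at this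
  refine this.trans ?_
  split_ifs <;> simp

/-! ### Invariance of high-order coefficients under subtraction of a polynomial. -/

theorem continuous_trigPoly (m : ℕ) (α γ : ℕ → ℝ) : Continuous (trigPoly m α γ) := by
  unfold trigPoly; fun_prop

theorem trigPoly_eq_sum (m : ℕ) (α γ : ℕ → ℝ) (x : ℝ) :
    trigPoly m α γ x = ∑ k ∈ Finset.range m, harmonic (α k) (γ k) k x := rfl

theorem fourierA_trigPoly (m : ℕ) (α γ : ℕ → ℝ) (k : ℕ) (hk1 : 1 ≤ k) (hk : m ≤ k) :
    fourierA (trigPoly m α γ) k = 0 := by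
  have h : ∀ i ∈ Finset.range m, ∫ t in (-π)..π, harmonic (α i) (γ i) i t * cos (k * t) = 0 := by
    intro i hi
    have h1 := fourierA_harmonic (α i) (γ i) i k hk1
    rw [Finset.mem_range] at hi
    rw [if_neg (by omega), fourierA] at h1
    simpa [pi_ne_zero] using h1
  simp only [fourierA, trigPoly_eq_sum, Finset.sum_mul]
  rw [intervalIntegral.integral_finsetSum, Finset.sum_eq_zero h, mul_zero]
  intro i _
  exact Continuous.intervalIntegrable ((continuous_harmonic _ _ _).mul (by fun_prop)) _ _

theorem fourierB_trigPoly (m : ℕ) (α γ : ℕ → ℝ) (k : ℕ) (hk1 : 1 ≤ k) (hk : m ≤ k) :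
    fourierB (trigPoly m α γ) k = 0 := by
  have h : ∀ i ∈ Finset.range m, ∫ t in (-π)..π, harmonic (α i) (γ i) i t * sin (k * t) = 0 := by
    intro i hi
    have h1 := fourierB_harmonic (α i) (γ i) i k hk1
    rw [Finset.mem_range] at hi
    rw [if_neg (by omega), fourierB] at h1
    simpa [pi_ne_zero] using h1
  simp only [fourierB, trigPoly_eq_sum, Finset.sum_mul]
  rw [intervalIntegral.integral_finsetSum, Finset.sum_eq_zero h, mul_zero]
  intro i _
  exact Continuous.intervalIntegrable ((continuous_harmonic _ _ _).mul (by fun_prop)) _ _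

theorem fourierA_sub_trigPoly {g : ℝ → ℝ} (hg : IntervalIntegrable g volume (-π) π)
    (m : ℕ) (α γ : ℕ → ℝ) (k : ℕ) (hk1 : 1 ≤ k) (hk : m ≤ k) :
    fourierA (fun t => g t - trigPoly m α γ t) k = fourierA g k := by
  have h := fourierA_linear hg ((continuous_trigPoly m α γ).intervalIntegrable _ _) 1 (-1) k
  rw [fourierA_trigPoly m α γ k hk1 hk] at h
  simpa [sub_eq_add_neg] using h

theorem fourierB_sub_trigPoly {g : ℝ → ℝ} (hg : IntervalIntegrable g volume (-π) π)
    (m : ℕ) (α γ : ℕ → ℝ) (k : ℕ) (hk1 : 1 ≤ k) (hk : m ≤ k) :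
    fourierB (fun t => g t - trigPoly m α γ t) k = fourierB g k := by
  have h := fourierB_linear hg ((continuous_trigPoly m α γ).intervalIntegrable _ _) 1 (-1) k
  rw [fourierB_trigPoly m α γ k hk1 hk] at h
  simpa [sub_eq_add_neg] using h

theorem integral_mul_cos_add {g : ℝ → ℝ} (hg : IntervalIntegrable g volume (-π) π)
    (k : ℕ) (c : ℝ) :
    (1 / π) * ∫ t in (-π)..π, g t * cos (k * t + c) =
      fourierA g k * cos c - fourierB g k * sin c := by
  have h : ∀ t : ℝ, g t * cos (k * t + c) =
      cos c * (g t * cos (k * t)) - sin c * (g t * sin (k * t)) := fun t => by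
    rw [cos_add]; ring
  simp only [h, fourierA, fourierB]
  rw [intervalIntegral.integral_sub ((intervalIntegrable_mul_cos hg k).const_mul _)
    ((intervalIntegrable_mul_sin hg k).const_mul _), intervalIntegral.integral_const_mul,
    intervalIntegral.integral_const_mul]
  ring

/-! ### Absolutely convergent Fourier series -/

instance fact_two_pi_pos : Fact (0 < 2 * π) := ⟨two_pi_pos⟩

/-- A continuous periodic function as a complex function on the circle. -/
def circleLift (f : ℝ → ℝ) (hf : MemC f) : C(AddCircle (2 * π), ℂ) where
  toFun t := (hf.2.lift t : ℂ)
  continuous_toFun := by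
    refine Complex.continuous_ofReal.comp ?_
    exact continuous_coinduced_dom.mpr (by simpa [Function.comp_def] using! hf.1)

theorem fourier_two_pi_apply (j : ℤ) (x : ℝ) :
    fourier j (x : AddCircle (2 * π)) = (cos (j * x) : ℂ) + (sin (j * x) : ℂ) * Complex.I := by
  rw [fourier_coe_apply, Complex.ofReal_cos, Complex.ofReal_sin, ← Complex.exp_mul_I]
  congr 1
  have : (π : ℂ) ≠ 0 := by exact_mod_cast pi_ne_zero
  push_cast
  field_simp

theorem fourierCoeff_circleLift (f : ℝ → ℝ) (hf : MemC f) (j : ℤ) :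
    fourierCoeff (circleLift f hf) j = (1 / (2 * π) : ℂ) *
      (((∫ t in (-π)..π, f t * cos (j * t) : ℝ) : ℂ) -
        ((∫ t in (-π)..π, f t * sin (j * t) : ℝ) : ℂ) * Complex.I) := by
  rw [fourierCoeff_eq_intervalIntegral _ _ (-π)]
  have h1 : ∀ t : ℝ, fourier (-j) (t : AddCircle (2 * π)) • circleLift f hf t =
      ((f t * cos (j * t) : ℝ) : ℂ) - ((f t * sin (j * t) : ℝ) : ℂ) * Complex.I := by
    intro t
    have : circleLift f hf t = (f t : ℂ) := rfl
    rw [this, fourier_two_pi_apply]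
    push_cast
    rw [neg_mul, Complex.cos_neg, Complex.sin_neg, smul_eq_mul]
    ring
  have hc := hf.1
  simp only [h1]
  rw [show -π + 2 * π = π by ring, intervalIntegral.integral_sub
    (Continuous.intervalIntegrable (by fun_prop) _ _)
    (Continuous.intervalIntegrable (by fun_prop) _ _),
    intervalIntegral.integral_mul_const, intervalIntegral.integral_ofReal,
    intervalIntegral.integral_ofReal, Complex.real_smul]
  push_cast
  rfl

theorem fourierCoeff_circleLift_natCast (f : ℝ → ℝ) (hf : MemC f) (k : ℕ) :
    fourierCoeff (circleLift f hf) k = ((fourierA f k : ℂ) - fourierB f k * Complex.I) / 2 := by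
  rw [fourierCoeff_circleLift, fourierA, fourierB]
  push_cast
  ring

theorem fourierCoeff_circleLift_neg (f : ℝ → ℝ) (hf : MemC f) (k : ℕ) :
    fourierCoeff (circleLift f hf) (-k) = ((fourierA f k : ℂ) + fourierB f k * Complex.I) / 2 := by
  rw [fourierCoeff_circleLift, fourierA, fourierB]
  push_cast
  simp only [neg_mul, cos_neg, sin_neg, mul_neg, intervalIntegral.integral_neg]
  push_cast
  ring

/-- A continuous function on the circle with summable complex Fourier coefficients is the pointwise
sum of its series; pairing frequencies `±k` and taking real parts gives the real form. -/
theorem hasSum_fourierSeries (f : ℝ → ℝ) (hf : MemC f)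
    (hs : Summable fun i : ℕ => |fourierA f (i + 1)| + |fourierB f (i + 1)|) (x : ℝ) :
    HasSum (fun i : ℕ => harmonic (fourierA f (i + 1)) (fourierB f (i + 1)) (i + 1) x)
      (f x - fourierA f 0 / 2) := by
  have hs' : Summable fun k : ℕ => |fourierA f k| + |fourierB f k| :=
    (summable_nat_add_iff (f := fun k : ℕ => |fourierA f k| + |fourierB f k|) 1).mp hs
  have hbound : ∀ a b : ℝ, ‖((a : ℂ) + b * Complex.I) / 2‖ ≤ |a| + |b| := by
    intro a b
    rw [norm_div]
    have := norm_add_le (a : ℂ) (b * Complex.I)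
    simp only [norm_mul, Complex.norm_real, Complex.norm_I, mul_one, Real.norm_eq_abs] at this
    have h2 : ‖(2 : ℂ)‖ = 2 := by simp
    rw [h2]
    have h3 := norm_nonneg ((a : ℂ) + b * Complex.I)
    linarith
  have hsum : Summable (fourierCoeff (circleLift f hf)) := by
    refine Summable.of_nat_of_neg ?_ ?_
    · refine Summable.of_norm_bounded hs' fun k => ?_
      rw [fourierCoeff_circleLift_natCast]
      have := hbound (fourierA f k) (-fourierB f k)
      rw [abs_neg] at this
      simpa [sub_eq_add_neg] using this
    · refine Summable.of_norm_bounded hs' fun k => ?_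
      rw [fourierCoeff_circleLift_neg]
      exact hbound _ _
  -- Pairing `j` with `-j` counts the zeroth term twice. Dropping index `0` from the paired series
  -- removes both copies, so the sum becomes `f x` minus one zeroth coefficient, which is `fourierA
  -- f 0 / 2`.
  have h1 := (has_pointwise_sum_fourier_series_of_summable hsum (x : AddCircle (2 * π))).nat_add_neg
  have h2 := (hasSum_nat_add_iff' 1).mpr (Complex.reCLM.hasSum h1)
  have hval : circleLift f hf x = (f x : ℂ) := rfl
  have h0 := fourierCoeff_circleLift_natCast f hf 0
  have hB0 : fourierB f 0 = 0 := by simp [fourierB]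
  rw [Nat.cast_zero] at h0
  convert! h2 using 1
  · ext i
    rw [fourierCoeff_circleLift_natCast, fourierCoeff_circleLift_neg, fourier_two_pi_apply,
      fourier_two_pi_apply, harmonic]
    push_cast
    rw [neg_mul, Complex.cos_neg, Complex.sin_neg]
    have : (((fourierA f (i + 1) : ℂ) - fourierB f (i + 1) * Complex.I) / 2) •
        (Complex.cos ((i + 1) * x) + Complex.sin ((i + 1) * x) * Complex.I) +
        (((fourierA f (i + 1) : ℂ) + fourierB f (i + 1) * Complex.I) / 2) •
        (Complex.cos ((i + 1) * x) + -Complex.sin ((i + 1) * x) * Complex.I) =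
        ((fourierA f (i + 1) * cos ((i + 1) * x) + fourierB f (i + 1) * sin ((i + 1) * x) : ℝ) : ℂ) := by
      push_cast
      simp only [smul_eq_mul]
      linear_combination (-(fourierB f (i + 1) : ℂ) * Complex.sin ((i + 1) * x)) * Complex.I_sq
    rw [this]
    exact (Complex.ofReal_re _).symm
  · simp [hval, h0, hB0]
    ring

/-! ### Functions with prescribed Fourier coefficients -/

/-- The sum of the harmonics `c_k cos kx + d_k sin kx` over `k ≥ 1`. -/
def harmonicSeries (c d : ℕ → ℝ) (x : ℝ) : ℝ :=
  ∑' i : ℕ, harmonic (c (i + 1)) (d (i + 1)) (i + 1) x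

theorem memC_harmonicSeries (c d : ℕ → ℝ) (hs : Summable fun i => |c (i + 1)| + |d (i + 1)|) :
    MemC (harmonicSeries c d) := by
  constructor
  · exact continuous_tsum (fun i => continuous_harmonic _ _ _) hs fun i x => abs_harmonic_le _ _ _ _
  · intro x
    unfold harmonicSeries
    congr 1
    ext i
    exact periodic_harmonic _ _ _ x

/-- Termwise integration by dominated convergence; `w` will be `cos kt` or `sin kt`, to read off the
coefficients of the sum. -/
theorem hasSum_integral_harmonic_mul (c d : ℕ → ℝ)
    (hs : Summable fun i => |c (i + 1)| + |d (i + 1)|) (w : ℝ → ℝ) (hw : Continuous w)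
    (hw1 : ∀ t, |w t| ≤ 1) :
    HasSum (fun i : ℕ => ∫ t in (-π)..π, harmonic (c (i + 1)) (d (i + 1)) (i + 1) t * w t)
      (∫ t in (-π)..π, harmonicSeries c d t * w t) := by
  refine intervalIntegral.hasSum_integral_of_dominated_convergence
    (F := fun i t => harmonic (c (i + 1)) (d (i + 1)) (i + 1) t * w t) (fun i _ => |c (i + 1)| + |d (i + 1)|) ?_ ?_ ?_ ?_ ?_
  · intro i
    exact ((continuous_harmonic (c (i + 1)) (d (i + 1)) (i + 1)).mul hw).aestronglyMeasurable
  · intro i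
    refine Eventually.of_forall fun t _ => ?_
    rw [norm_mul]
    exact (mul_le_of_le_one_right (norm_nonneg _) (hw1 t)).trans (abs_harmonic_le _ _ _ _)
  · exact Eventually.of_forall fun t _ => hs
  · exact intervalIntegrable_const
  · refine Eventually.of_forall fun t _ => ?_
    have h : Summable fun i => harmonic (c (i + 1)) (d (i + 1)) (i + 1) t :=
      Summable.of_norm_bounded hs fun i => abs_harmonic_le _ _ _ _
    exact h.hasSum.mul_right _

theorem fourierA_harmonicSeries (c d : ℕ → ℝ) (hs : Summable fun i => |c (i + 1)| + |d (i + 1)|)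
    (k : ℕ) (hk : 1 ≤ k) : fourierA (harmonicSeries c d) k = c k := by
  have h := (hasSum_integral_harmonic_mul c d hs (fun t => cos (k * t)) (by fun_prop)
    fun t => abs_cos_le_one _).mul_left (1 / π)
  refine h.unique ?_
  obtain ⟨l, rfl⟩ : ∃ l, k = l + 1 := ⟨k - 1, by omega⟩
  have h1 : ∀ i, 1 / π * ∫ t in (-π)..π, harmonic (c (i + 1)) (d (i + 1)) (i + 1) t *
      cos ((l + 1 : ℕ) * t) = if i = l then c (l + 1) else 0 := by
    intro i
    refine (fourierA_harmonic (c (i + 1)) (d (i + 1)) (i + 1) (l + 1) (by omega)).trans ?_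
    by_cases hil : i = l
    · simp [hil]
    · simp [hil]
  simp only [h1]
  exact hasSum_ite_eq l _

theorem fourierB_harmonicSeries (c d : ℕ → ℝ) (hs : Summable fun i => |c (i + 1)| + |d (i + 1)|)
    (k : ℕ) (hk : 1 ≤ k) : fourierB (harmonicSeries c d) k = d k := by
  have h := (hasSum_integral_harmonic_mul c d hs (fun t => sin (k * t)) (by fun_prop)
    fun t => abs_sin_le_one _).mul_left (1 / π)
  refine h.unique ?_
  obtain ⟨l, rfl⟩ : ∃ l, k = l + 1 := ⟨k - 1, by omega⟩
  have h1 : ∀ i, 1 / π * ∫ t in (-π)..π, harmonic (c (i + 1)) (d (i + 1)) (i + 1) t *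
      sin ((l + 1 : ℕ) * t) = if i = l then d (l + 1) else 0 := by
    intro i
    refine (fourierB_harmonic (c (i + 1)) (d (i + 1)) (i + 1) (l + 1) (by omega)).trans ?_
    by_cases hil : i = l
    · simp [hil]
    · simp [hil]
  simp only [h1]
  exact hasSum_ite_eq l _

/-! ### Norms over a period -/

instance isFiniteMeasure_periodMeasure : IsFiniteMeasure periodMeasure := by
  unfold periodMeasure; infer_instance

theorem integral_periodMeasure (g : ℝ → ℝ) : ∫ t, g t ∂periodMeasure = ∫ t in (-π)..π, g t := by
  rw [intervalIntegral.integral_of_le (by linarith [pi_pos]), periodMeasure]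

theorem intervalIntegrable_of_memLp {g : ℝ → ℝ} {s : ℝ≥0∞} (hs : 1 ≤ s)
    (hg : MemLp g s periodMeasure) : IntervalIntegrable g volume (-π) π := by
  rw [intervalIntegrable_iff_integrableOn_Ioc_of_le (by linarith [pi_pos])]
  exact hg.integrable hs

theorem lsNorm_nonneg (s : ℝ≥0∞) (g : ℝ → ℝ) : 0 ≤ lsNorm s g := ENNReal.toReal_nonneg

theorem lsNorm_const_mul (s : ℝ≥0∞) (a : ℝ) (g : ℝ → ℝ) :
    lsNorm s (fun t => a * g t) = |a| * lsNorm s g := by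
  have := eLpNorm_const_smul a g s periodMeasure
  rw [lsNorm, lsNorm]
  have h2 : (fun t => a * g t) = a • g := rfl
  rw [h2, this, ENNReal.toReal_mul]
  simp

theorem holderConjugate_conjExp {s : ℝ≥0∞} (h1 : 1 ≤ s) (h2 : s < ∞) :
    ENNReal.HolderConjugate s (conjExp s) := by
  have h0 : s ≠ 0 := (zero_lt_one.trans_le h1).ne'
  rw [ENNReal.holderConjugate_iff, conjExp, ENNReal.inv_div (Or.inr h2.ne) (Or.inr h0),
    ENNReal.div_eq_inv_mul]
  nth_rewrite 1 [← mul_one s⁻¹]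
  rw [← mul_add, add_tsub_cancel_of_le h1, ENNReal.inv_mul_cancel h0 h2.ne]

theorem abs_integral_mul_le {s s' : ℝ≥0∞} [ENNReal.HolderConjugate s s'] {g h : ℝ → ℝ}
    (hg : MemLp g s periodMeasure) (hh : MemLp h s' periodMeasure) :
    |∫ t in (-π)..π, g t * h t| ≤ lsNorm s g * lsNorm s' h := by
  rw [← integral_periodMeasure, lsNorm, lsNorm, ← ENNReal.toReal_mul]
  have h1 : eLpNorm (g • h) 1 periodMeasure ≤ eLpNorm g s periodMeasure * eLpNorm h s' periodMeasure :=
    eLpNorm_smul_le_mul_eLpNorm hh.1 hg.1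
  have h2 : (∫⁻ t, ‖g t * h t‖ₑ ∂periodMeasure) = eLpNorm (g • h) 1 periodMeasure := by
    rw [eLpNorm_one_eq_lintegral_enorm]; rfl
  have h3 := enorm_integral_le_lintegral_enorm (μ := periodMeasure) (fun t => g t * h t)
  rw [h2] at h3
  have h4 := ENNReal.toReal_mono
    (ENNReal.mul_lt_top hg.eLpNorm_lt_top hh.eLpNorm_lt_top).ne (h3.trans h1)
  simpa using h4

theorem memLp_of_measurable_of_bound {g : ℝ → ℝ} (hg : Measurable g) {B : ℝ} (hB : ∀ t, |g t| ≤ B)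
    (s : ℝ≥0∞) : MemLp g s periodMeasure :=
  MemLp.of_bound hg.aestronglyMeasurable B (Eventually.of_forall hB)

theorem lsNorm_eq_integral {q : ℝ≥0∞} (hq0 : q ≠ 0) (hq : q ≠ ∞) {g : ℝ → ℝ}
    (hg : MemLp g q periodMeasure) :
    lsNorm q g = (∫ t in (-π)..π, |g t| ^ q.toReal) ^ q.toReal⁻¹ := by
  rw [lsNorm, hg.eLpNorm_eq_integral_rpow_norm hq0 hq, ENNReal.toReal_ofReal, integral_periodMeasure]
  · rfl
  · exact rpow_nonneg (integral_nonneg fun t => rpow_nonneg (norm_nonneg _) _) _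

/-- The period has measure `2π ≥ 1`, hence `(2π)^{1/q} ≤ 2π`. The bound does not involve `q`, which
keeps the final constant independent of `s`. -/
theorem lsNorm_le_of_abs_le_one {q : ℝ≥0∞} (hq : 1 ≤ q) {g : ℝ → ℝ} (hg : ∀ t, |g t| ≤ 1) :
    lsNorm q g ≤ 2 * π := by
  have h := eLpNorm_le_of_ae_bound (p := q) (μ := periodMeasure) (f := g) (C := 1)
    (Eventually.of_forall hg)
  have hvol : periodMeasure Set.univ = ENNReal.ofReal (2 * π) := by
    rw [periodMeasure, Measure.restrict_apply_univ, Real.volume_Ioc]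
    congr 1; ring
  rw [hvol, ENNReal.ofReal_one, mul_one] at h
  have h1 : ENNReal.ofReal (2 * π) ^ q.toReal⁻¹ ≤ ENNReal.ofReal (2 * π) := by
    have h2 : (1 : ℝ≥0∞) ≤ ENNReal.ofReal (2 * π) := by
      rw [ENNReal.one_le_ofReal]; linarith [pi_gt_three]
    nth_rewrite 2 [← ENNReal.rpow_one (ENNReal.ofReal (2 * π))]
    refine ENNReal.rpow_le_rpow_of_exponent_le h2 ?_
    by_cases hq' : q = ∞
    · simp [hq']
    · refine inv_le_one_of_one_le₀ ?_
      simpa using ENNReal.toReal_mono hq' hq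
  have h3 := ENNReal.toReal_mono ENNReal.ofReal_ne_top (h.trans h1)
  rwa [ENNReal.toReal_ofReal (by positivity)] at h3

/-- The substitution sweeps `m` full periods, and the Jacobian `1/m` compensates. -/
theorem integral_comp_natMul_add {G : ℝ → ℝ} (hG : Function.Periodic G (2 * π))
    (hi : ∀ a b, IntervalIntegrable G volume a b) {m : ℕ} (hm : 1 ≤ m) (c : ℝ) :
    ∫ t in (-π)..π, G (m * t + c) = ∫ t in (-π)..π, G t := by
  have hm0 : (m : ℝ) ≠ 0 := by
    have : m ≠ 0 := by omega
    exact_mod_cast this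
  rw [intervalIntegral.integral_comp_mul_add G hm0]
  have h1 := hG.intervalIntegral_add_zsmul_eq (m : ℤ) (m * (-π) + c) hi
  have h2 : m * (-π) + c + (m : ℤ) • (2 * π) = m * π + c := by
    rw [zsmul_eq_mul]; push_cast; ring
  rw [h2] at h1
  rw [h1, hG.intervalIntegral_add_eq _ (-π), show -π + 2 * π = π by ring, zsmul_eq_mul, smul_eq_mul]
  push_cast
  field_simp

theorem intervalIntegrable_of_measurable_of_bound {g : ℝ → ℝ} (hg : Measurable g) {B : ℝ}
    (hB : ∀ t, |g t| ≤ B) (a b : ℝ) : IntervalIntegrable g volume a b :=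
  (intervalIntegrable_const (c := B)).mono_fun hg.aestronglyMeasurable
    (Eventually.of_forall fun t => (hB t).trans (le_abs_self B))

theorem lsNorm_comp_natMul_add {q : ℝ≥0∞} (hq0 : q ≠ 0) (hq : q ≠ ∞) {g : ℝ → ℝ}
    (hg : Measurable g) {B : ℝ} (hB : ∀ t, |g t| ≤ B) (hgp : Function.Periodic g (2 * π))
    {m : ℕ} (hm : 1 ≤ m) (c : ℝ) :
    lsNorm q (fun t => g (m * t + c)) = lsNorm q g := by
  rw [lsNorm_eq_integral hq0 hq (memLp_of_measurable_of_bound hg hB q),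
    lsNorm_eq_integral hq0 hq (memLp_of_measurable_of_bound (g := fun t => g (m * t + c))
      (hg.comp (by fun_prop)) (fun t => hB (m * t + c)) q)]
  congr 1
  refine integral_comp_natMul_add (G := fun t => |g t| ^ q.toReal) (fun t => by simp only [hgp t]) ?_
    hm c
  refine intervalIntegrable_of_measurable_of_bound (B := B ^ q.toReal) (by fun_prop) fun t => ?_
  rw [abs_of_nonneg (rpow_nonneg (abs_nonneg _) _)]
  exact rpow_le_rpow (abs_nonneg _) (hB t) ENNReal.toReal_nonneg

theorem lsNorm_top_le {g : ℝ → ℝ} {B : ℝ} (h0 : 0 ≤ B) (hB : ∀ t, |g t| ≤ B) :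
    lsNorm ∞ g ≤ B := by
  have h := eLpNorm_le_of_ae_bound (p := ∞) (μ := periodMeasure) (f := g) (C := B)
    (Eventually.of_forall hB)
  simp only [ENNReal.toReal_top, inv_zero, ENNReal.rpow_zero, one_mul] at h
  have h3 := ENNReal.toReal_mono ENNReal.ofReal_ne_top h
  rwa [ENNReal.toReal_ofReal h0] at h3

theorem memLp_cos (q : ℝ≥0∞) : MemLp cos q periodMeasure :=
  memLp_of_measurable_of_bound measurable_cos abs_cos_le_one q

/-- Otherwise `cos` would exceed its essential supremum on a nonempty open set around `0`, which has
positive measure. -/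
theorem one_le_lsNorm_top_cos : 1 ≤ lsNorm ∞ cos := by
  by_contra! hlt
  have h1 : ∀ᵐ t ∂periodMeasure, cos t ≤ lsNorm ∞ cos := by
    filter_upwards [enorm_ae_le_eLpNormEssSup cos periodMeasure] with t ht
    rw [← eLpNorm_exponent_top] at ht
    have h := ENNReal.toReal_mono (memLp_cos ∞).eLpNorm_lt_top.ne ht
    simp only [toReal_enorm, Real.norm_eq_abs] at h
    exact (le_abs_self _).trans h
  rw [periodMeasure, ae_restrict_iff' measurableSet_Ioc] at h1
  have hopen : IsOpen (Set.Ioo (-π) π ∩ {t | lsNorm ∞ cos < cos t}) :=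
    isOpen_Ioo.inter (isOpen_lt continuous_const continuous_cos)
  have hpos := hopen.measure_pos volume ⟨0, ⟨by simp [pi_pos], by simp [pi_pos]⟩, by simpa using hlt⟩
  refine hpos.ne' (measure_mono_null ?_ h1)
  rintro t ⟨ht1, ht2⟩
  simp only [Set.mem_compl_iff, Set.mem_ofPred_eq, not_forall, not_le]
  exact ⟨⟨ht1.1, ht1.2.le⟩, ht2⟩

theorem lsNorm_cos_comp_le {q : ℝ≥0∞} (hq0 : q ≠ 0) {m : ℕ} (hm : 1 ≤ m) (c : ℝ) :
    lsNorm q (fun t => cos (m * t + c)) ≤ lsNorm q cos := by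
  by_cases hq : q = ∞
  · rw [hq]
    exact (lsNorm_top_le zero_le_one fun t => abs_cos_le_one _).trans one_le_lsNorm_top_cos
  · exact (lsNorm_comp_natMul_add hq0 hq measurable_cos abs_cos_le_one cos_periodic hm c).le

/-! ### Best approximation -/

theorem bddBelow_bestApprox (m : ℕ) (s : ℝ≥0∞) (g : ℝ → ℝ) :
    BddBelow {r : ℝ | ∃ α γ : ℕ → ℝ, r = lsNorm s (fun x => g x - trigPoly m α γ x)} :=
  ⟨0, by rintro r ⟨α, γ, rfl⟩; exact lsNorm_nonneg _ _⟩

theorem bestApprox_nonneg (m : ℕ) (s : ℝ≥0∞) (g : ℝ → ℝ) : 0 ≤ bestApprox m s g :=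
  Real.sInf_nonneg (by rintro r ⟨α, γ, rfl⟩; exact lsNorm_nonneg _ _)

theorem bestApprox_le (m : ℕ) (s : ℝ≥0∞) (g : ℝ → ℝ) (α γ : ℕ → ℝ) :
    bestApprox m s g ≤ lsNorm s (fun x => g x - trigPoly m α γ x) :=
  csInf_le (bddBelow_bestApprox m s g) ⟨α, γ, rfl⟩

theorem bestApprox_le_lsNorm (m : ℕ) (s : ℝ≥0∞) (g : ℝ → ℝ) : bestApprox m s g ≤ lsNorm s g := by
  simpa [trigPoly] using bestApprox_le m s g 0 0

theorem le_mul_bestApprox {m : ℕ} {s : ℝ≥0∞} {g : ℝ → ℝ} {X K : ℝ} (hK : 0 ≤ K)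
    (h : ∀ α γ : ℕ → ℝ, X ≤ K * lsNorm s (fun x => g x - trigPoly m α γ x)) :
    X ≤ K * bestApprox m s g := by
  rcases hK.eq_or_lt with rfl | hK
  · simpa using h 0 0
  · rw [← div_le_iff₀' hK]
    refine le_csInf ⟨_, 0, 0, rfl⟩ ?_
    rintro r ⟨α, γ, rfl⟩
    rw [div_le_iff₀' hK]
    exact h α γ

theorem bestApprox_mul_sub_le {m : ℕ} (hm : 1 ≤ m) (s : ℝ≥0∞) (g : ℝ → ℝ) {a : ℝ} (ha : 0 ≤ a)
    (b : ℝ) : bestApprox m s (fun t => a * (g t - b)) ≤ a * bestApprox m s g := by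
  refine le_mul_bestApprox ha fun α γ => ?_
  refine (bestApprox_le m s _ (fun k => a * α k - if k = 0 then a * b else 0)
    (fun k => a * γ k)).trans (le_of_eq ?_)
  refine Eq.trans ?_ ((lsNorm_const_mul s a _).trans (by rw [abs_of_nonneg ha]))
  congr 1
  ext t
  have h : trigPoly m (fun k => a * α k - if k = 0 then a * b else 0) (fun k => a * γ k) t =
      a * trigPoly m α γ t - a * b := by
    have h1 : ∀ k : ℕ, (a * α k - if k = 0 then a * b else 0) * cos (k * t) +
        a * γ k * sin (k * t) = a * (α k * cos (k * t) + γ k * sin (k * t)) -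
          if k = 0 then a * b else 0 := by
      intro k
      by_cases hk : k = 0
      · simp [hk]
      · simp [hk]; ring
    simp only [trigPoly, h1, Finset.sum_sub_distrib, ← Finset.mul_sum]
    rw [Finset.sum_ite_eq' (Finset.range m) 0, if_pos (Finset.mem_range.mpr hm)]
  rw [h]
  ring

theorem bestApprox_mul_sub {m : ℕ} (hm : 1 ≤ m) (s : ℝ≥0∞) (g : ℝ → ℝ) {a : ℝ} (ha : 0 ≤ a)
    (b : ℝ) : bestApprox m s (fun t => a * (g t - b)) = a * bestApprox m s g := by
  refine le_antisymm (bestApprox_mul_sub_le hm s g ha b) ?_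
  rcases ha.eq_or_lt with rfl | ha'
  · rw [zero_mul]; exact bestApprox_nonneg _ _ _
  -- The reverse inequality is the same bound applied to the inverse affine map.
  · have h := bestApprox_mul_sub_le hm s (fun t => a * (g t - b)) (inv_nonneg.mpr ha) (-(a * b))
    have h2 : (fun t => a⁻¹ * (a * (g t - b) - -(a * b))) = g := by
      ext t; field_simp; ring
    rw [h2] at h
    have h3 := mul_le_mul_of_nonneg_left h ha
    rwa [← mul_assoc, mul_inv_cancel₀ ha'.ne', one_mul] at h3

/-! ### Extremal functions in Hölder's inequality -/

/-- For `s > 1` the function `cos |cos|^{s'-2}` gives equality in Hölder, because `(s' - 1) s = s'`.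
For `s = 1` one concentrates `h ≥ 0` where `cos > 1 - ε`, which is why the factor `1 - ε` appears.
-/
theorem exists_nearly_extremal_cos {s : ℝ≥0∞} (h1 : 1 ≤ s) (h2 : s < ∞) {ε : ℝ} (hε0 : 0 < ε)
    (hε1 : ε < 1) : ∃ h : ℝ → ℝ, Measurable h ∧ (∃ B, ∀ t, |h t| ≤ B) ∧
      Function.Periodic h (2 * π) ∧ 0 < ∫ t in (-π)..π, h t * cos t ∧
      (1 - ε) * lsNorm s h * lsNorm (conjExp s) cos ≤ ∫ t in (-π)..π, h t * cos t := by
  have hpi := pi_pos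
  rcases h1.eq_or_lt with rfl | h1'
  · set h : ℝ → ℝ := fun t => max 0 (cos t - (1 - ε)) with hdef
    have hc : Continuous h := by fun_prop
    have hB : ∀ t, |h t| ≤ 1 := fun t => by
      rw [abs_of_nonneg (le_max_left _ _)]
      exact max_le zero_le_one (by linarith [cos_le_one t])
    have hle : ∀ t, (1 - ε) * h t ≤ h t * cos t := by
      intro t
      rcases le_total (cos t - (1 - ε)) 0 with ht | ht
      · simp [hdef, max_eq_left ht]
      · simp only [hdef, max_eq_right ht]; nlinarith
    have hpos : 0 < ∫ t in (-π)..π, h t :=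
      intervalIntegral.integral_pos (by linarith) hc.continuousOn (fun t _ => le_max_left _ _)
        ⟨0, ⟨by linarith, hpi.le⟩, by simp [hdef, hε0]⟩
    have hint : (1 - ε) * ∫ t in (-π)..π, h t ≤ ∫ t in (-π)..π, h t * cos t := by
      rw [← intervalIntegral.integral_const_mul]
      exact intervalIntegral.integral_mono_on (by linarith)
        (Continuous.intervalIntegrable (by fun_prop) _ _)
        (Continuous.intervalIntegrable (by fun_prop) _ _) fun t _ => hle t
    refine ⟨h, hc.measurable, ⟨1, hB⟩, fun t => by simp [hdef], ?_, ?_⟩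
    · have := mul_pos (sub_pos.mpr hε1) hpos
      linarith
    · have hn : lsNorm 1 h = ∫ t in (-π)..π, h t := by
        rw [lsNorm_eq_integral one_ne_zero ENNReal.one_ne_top
          (memLp_of_measurable_of_bound hc.measurable hB 1)]
        simp only [ENNReal.toReal_one, rpow_one, inv_one]
        congr 1
        ext t
        exact abs_of_nonneg (le_max_left _ _)
      have hcos : lsNorm (conjExp 1) cos ≤ 1 := by
        simpa [conjExp] using lsNorm_top_le zero_le_one abs_cos_le_one
      rw [hn]
      have hnn : 0 ≤ (1 - ε) * ∫ t in (-π)..π, h t := mul_nonneg (by linarith) hpos.le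
      exact (mul_le_of_le_one_right hnn hcos).trans hint
  · have := holderConjugate_conjExp h1 h2
    have hq1 : 1 < conjExp s := (ENNReal.HolderConjugate.lt_top_iff_one_lt s (conjExp s)).mp h2
    have hqt : conjExp s ≠ ∞ := by
      rw [ENNReal.HolderConjugate.ne_top_iff_ne_one (conjExp s) s]; exact h1'.ne'
    have hconj := ENNReal.HolderConjugate.toReal_of_ne_top (p := s) (q := conjExp s) h2.ne hqt
    set q := conjExp s with hqdef
    set r := q.toReal with hr
    have hr1 : 1 < r := hconj.symm.lt
    set h : ℝ → ℝ := fun t => cos t * |cos t| ^ (r - 2) with hdef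
    have habs : ∀ t, |h t| = |cos t| ^ (r - 1) := by
      intro t
      rw [hdef]
      simp only
      rw [abs_mul, abs_of_nonneg (rpow_nonneg (abs_nonneg _) _)]
      rcases (abs_nonneg (cos t)).eq_or_lt with h0 | h0
      · rw [← h0, zero_mul, zero_rpow (by linarith)]
      · nth_rewrite 1 [← rpow_one |cos t|]
        rw [← rpow_add h0]
        congr 1; ring
    have hmul : ∀ t, h t * cos t = |cos t| ^ r := by
      intro t
      rw [hdef]
      simp only
      rw [mul_right_comm, ← abs_mul_abs_self]
      rcases (abs_nonneg (cos t)).eq_or_lt with h0 | h0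
      · rw [← h0, zero_mul, zero_mul, zero_rpow (by linarith)]
      · nth_rewrite 1 [← rpow_one |cos t|]
        nth_rewrite 2 [← rpow_one |cos t|]
        rw [← rpow_add h0, ← rpow_add h0]
        congr 1; ring
    have hB : ∀ t, |h t| ≤ 1 := fun t => by
      rw [habs]
      exact rpow_le_one (abs_nonneg _) (abs_cos_le_one t) (by linarith)
    have hmeas : Measurable h := by fun_prop
    have hpos : 0 < ∫ t in (-π)..π, |cos t| ^ r := by
      refine intervalIntegral.integral_pos (by linarith) ?_
        (fun t _ => rpow_nonneg (abs_nonneg _) _) ⟨0, ⟨by linarith, hpi.le⟩, by simp⟩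
      exact (continuous_cos.abs.rpow_const fun t => Or.inr (by linarith)).continuousOn
    have hI : ∫ t in (-π)..π, h t * cos t = ∫ t in (-π)..π, |cos t| ^ r := by simp only [hmul]
    refine ⟨h, hmeas, ⟨1, hB⟩, fun t => by simp [hdef], by rw [hI]; exact hpos, ?_⟩
    have hn : lsNorm s h = (∫ t in (-π)..π, |cos t| ^ r) ^ s.toReal⁻¹ := by
      rw [lsNorm_eq_integral (zero_lt_one.trans h1').ne' h2.ne
        (memLp_of_measurable_of_bound hmeas hB s)]
      congr 2
      ext t
      rw [habs, ← rpow_mul (abs_nonneg _), hconj.symm.sub_one_mul_conj]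
    have hcos : lsNorm q cos = (∫ t in (-π)..π, |cos t| ^ r) ^ r⁻¹ :=
      lsNorm_eq_integral (zero_lt_one.trans hq1).ne' hqt (memLp_cos q)
    rw [hI, mul_assoc, hn, hcos, ← rpow_add hpos, hconj.inv_add_inv_eq_one, rpow_one]
    exact mul_le_of_le_one_left hpos.le (by linarith)

/-! ### The class `D₀` -/

theorem ClassD0.summable {ψ : ℕ → ℝ} (hψ : ClassD0 ψ) : Summable ψ := by
  refine summable_of_ratio_test_tendsto_lt_one zero_lt_one ?_ ?_
  · filter_upwards [eventually_ge_atTop 1] with k hk using (hψ.1 k hk).ne'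
  · refine hψ.2.congr' ?_
    filter_upwards [eventually_ge_atTop 1] with k hk
    rw [Real.norm_of_nonneg (hψ.1 k hk).le, Real.norm_of_nonneg (hψ.1 (k + 1) (by omega)).le]

theorem tailTerm_nonneg {ψ : ℕ → ℝ} (hψ : ClassD0 ψ) {n p : ℕ} (hp : 1 ≤ p) (i : ℕ) :
    0 ≤ tailTerm ψ n p i :=
  mul_nonneg (hψ.1 _ (by omega)).le (tau_nonneg n p _ hp (by omega))

theorem summable_tailTerm {ψ : ℕ → ℝ} (hψ : ClassD0 ψ) {n p : ℕ} (hp : 1 ≤ p) :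
    Summable (tailTerm ψ n p) := by
  have h := (summable_nat_add_iff (n - p + 2)).mpr hψ.summable
  refine Summable.of_nonneg_of_le (tailTerm_nonneg hψ hp) (fun i => ?_) h
  rw [tailTerm, add_comm i]
  exact mul_le_of_le_one_right (hψ.1 _ (by omega)).le (tau_le_one _ _ _)

theorem tsum_tailTerm_pos {ψ : ℕ → ℝ} (hψ : ClassD0 ψ) {n p : ℕ} (hp : 1 ≤ p) :
    0 < ∑' i, tailTerm ψ n p i := by
  refine (summable_tailTerm hψ hp).tsum_pos (tailTerm_nonneg hψ hp) p ?_
  -- The index `i = p` stands for a frequency `k ≥ n`, where `τ = 1`.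
  rw [tailTerm, tau, if_neg (by omega), mul_one]
  exact hψ.1 _ (by omega)

/-! ### Bounds for Fourier coefficients -/

/-- Hölder with the crude bound `2π` for the norm of the kernel; the factor `1/π` leaves `2`. -/
theorem abs_fourierA_le {s : ℝ≥0∞} (h1 : 1 ≤ s) (h2 : s < ∞) {g : ℝ → ℝ}
    (hg : MemLp g s periodMeasure) (k : ℕ) : |fourierA g k| ≤ 2 * lsNorm s g := by
  have := holderConjugate_conjExp h1 h2
  have hb : ∀ t : ℝ, |cos (k * t)| ≤ 1 := fun t => abs_cos_le_one _
  have h := abs_integral_mul_le (s' := conjExp s) hg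
    (memLp_of_measurable_of_bound (g := fun t => cos (k * t)) (by fun_prop) hb _)
  have h3 := lsNorm_le_of_abs_le_one (ENNReal.HolderConjugate.one_le (conjExp s) s) hb
  have h4 := h.trans (mul_le_mul_of_nonneg_left h3 (lsNorm_nonneg _ _))
  rw [fourierA, abs_mul, abs_of_pos (by positivity), one_div, inv_mul_le_iff₀ pi_pos]
  linarith

theorem abs_fourierB_le {s : ℝ≥0∞} (h1 : 1 ≤ s) (h2 : s < ∞) {g : ℝ → ℝ}
    (hg : MemLp g s periodMeasure) (k : ℕ) : |fourierB g k| ≤ 2 * lsNorm s g := by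
  have := holderConjugate_conjExp h1 h2
  have hb : ∀ t : ℝ, |sin (k * t)| ≤ 1 := fun t => abs_sin_le_one _
  have h := abs_integral_mul_le (s' := conjExp s) hg
    (memLp_of_measurable_of_bound (g := fun t => sin (k * t)) (by fun_prop) hb _)
  have h3 := lsNorm_le_of_abs_le_one (ENNReal.HolderConjugate.one_le (conjExp s) s) hb
  have h4 := h.trans (mul_le_mul_of_nonneg_left h3 (lsNorm_nonneg _ _))
  rw [fourierB, abs_mul, abs_of_pos (by positivity), one_div, inv_mul_le_iff₀ pi_pos]
  linarith

theorem memLp_trigPoly (m : ℕ) (α γ : ℕ → ℝ) (s : ℝ≥0∞) :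
    MemLp (trigPoly m α γ) s periodMeasure := by
  refine memLp_of_measurable_of_bound (continuous_trigPoly m α γ).measurable
    (B := ∑ k ∈ Finset.range m, (|α k| + |γ k|)) (fun t => ?_) s
  rw [trigPoly_eq_sum]
  exact (Finset.abs_sum_le_sum_abs _ _).trans
    (Finset.sum_le_sum fun k _ => abs_harmonic_le _ _ _ _)

theorem abs_fourierA_le_bestApprox {s : ℝ≥0∞} (h1 : 1 ≤ s) (h2 : s < ∞) {g : ℝ → ℝ}
    (hg : MemLp g s periodMeasure) {m k : ℕ} (hk1 : 1 ≤ k) (hk : m ≤ k) :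
    |fourierA g k| ≤ 2 * bestApprox m s g := by
  refine le_mul_bestApprox zero_le_two fun α γ => ?_
  rw [← fourierA_sub_trigPoly (intervalIntegrable_of_memLp h1 hg) m α γ k hk1 hk]
  exact abs_fourierA_le h1 h2 (hg.sub (memLp_trigPoly m α γ s)) k

theorem abs_fourierB_le_bestApprox {s : ℝ≥0∞} (h1 : 1 ≤ s) (h2 : s < ∞) {g : ℝ → ℝ}
    (hg : MemLp g s periodMeasure) {m k : ℕ} (hk1 : 1 ≤ k) (hk : m ≤ k) :
    |fourierB g k| ≤ 2 * bestApprox m s g := by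
  refine le_mul_bestApprox zero_le_two fun α γ => ?_
  rw [← fourierB_sub_trigPoly (intervalIntegrable_of_memLp h1 hg) m α γ k hk1 hk]
  exact abs_fourierB_le h1 h2 (hg.sub (memLp_trigPoly m α γ s)) k

/-- The kernel of order `m` is orthogonal to polynomials of order below `m`, so Hölder may be
applied to `g` minus any such polynomial. -/
theorem abs_integral_mul_cos_le_bestApprox {s : ℝ≥0∞} (h1 : 1 ≤ s) (h2 : s < ∞) {g : ℝ → ℝ}
    (hg : MemLp g s periodMeasure) {m : ℕ} (hm : 1 ≤ m) (c : ℝ) :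
    |∫ t in (-π)..π, g t * cos (m * t + c)| ≤ lsNorm (conjExp s) cos * bestApprox m s g := by
  have := holderConjugate_conjExp h1 h2
  refine le_mul_bestApprox (lsNorm_nonneg _ _) fun α γ => ?_
  have hg' : MemLp (fun t => g t - trigPoly m α γ t) s periodMeasure :=
    hg.sub (memLp_trigPoly m α γ s)
  have e1 := integral_mul_cos_add (intervalIntegrable_of_memLp h1 hg) m c
  have e2 := integral_mul_cos_add (intervalIntegrable_of_memLp h1 hg') m c
  rw [fourierA_sub_trigPoly (intervalIntegrable_of_memLp h1 hg) m α γ m hm le_rfl,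
    fourierB_sub_trigPoly (intervalIntegrable_of_memLp h1 hg) m α γ m hm le_rfl, ← e1] at e2
  rw [← mul_left_cancel₀ (one_div_ne_zero pi_ne_zero) e2, mul_comm (lsNorm _ cos)]
  refine (abs_integral_mul_le (s' := conjExp s) hg'
    (memLp_of_measurable_of_bound (by fun_prop) (fun t => abs_cos_le_one (m * t + c)) _)).trans ?_
  exact mul_le_mul_of_nonneg_left
    (lsNorm_cos_comp_le (ENNReal.HolderConjugate.ne_zero (conjExp s) s) hm c) (lsNorm_nonneg _ _)

/-! ### The `(ψ, β)`-integral -/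

/-- The cosine coefficient of the `(ψ, β)`-integral of `φ`. -/
def integralA (ψ β : ℕ → ℝ) (φ : ℝ → ℝ) (k : ℕ) : ℝ :=
  ψ k * (fourierA φ k * cos (β k * π / 2) - fourierB φ k * sin (β k * π / 2))

/-- The sine coefficient of the `(ψ, β)`-integral of `φ`. -/
def integralB (ψ β : ℕ → ℝ) (φ : ℝ → ℝ) (k : ℕ) : ℝ :=
  ψ k * (fourierA φ k * sin (β k * π / 2) + fourierB φ k * cos (β k * π / 2))

theorem IsPsiBetaDeriv.fourierA_eq {ψ β : ℕ → ℝ} (hψ : ClassD0 ψ) {f φ : ℝ → ℝ}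
    (h : IsPsiBetaDeriv ψ β f φ) {k : ℕ} (hk : 1 ≤ k) : fourierA f k = integralA ψ β φ k := by
  have h0 := (hψ.1 k hk).ne'
  rw [integralA, h.cos_coeff k hk, h.sin_coeff k hk]
  field_simp
  linear_combination (-fourierA f k) * sin_sq_add_cos_sq (β k * π / 2)

theorem IsPsiBetaDeriv.fourierB_eq {ψ β : ℕ → ℝ} (hψ : ClassD0 ψ) {f φ : ℝ → ℝ}
    (h : IsPsiBetaDeriv ψ β f φ) {k : ℕ} (hk : 1 ≤ k) : fourierB f k = integralB ψ β φ k := by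
  have h0 := (hψ.1 k hk).ne'
  rw [integralB, h.cos_coeff k hk, h.sin_coeff k hk]
  field_simp
  linear_combination (-fourierB f k) * sin_sq_add_cos_sq (β k * π / 2)

theorem abs_integralA_add_abs_integralB_le {ψ β : ℕ → ℝ} {φ : ℝ → ℝ} {k : ℕ} (hk : 0 ≤ ψ k)
    {M : ℝ} (hA : |fourierA φ k| ≤ M) (hB : |fourierB φ k| ≤ M) :
    |integralA ψ β φ k| + |integralB ψ β φ k| ≤ ψ k * (4 * M) := by
  have hc := abs_cos_le_one (β k * π / 2)
  have hs := abs_sin_le_one (β k * π / 2)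
  have h1 : ∀ a y : ℝ, |a| ≤ M → |y| ≤ 1 → |a * y| ≤ M := fun a y ha hy => by
    rw [abs_mul]; exact (mul_le_of_le_one_right (abs_nonneg _) hy).trans ha
  rw [integralA, integralB, abs_mul, abs_mul, abs_of_nonneg hk, ← mul_add]
  refine mul_le_mul_of_nonneg_left ?_ hk
  have e1 := abs_sub (fourierA φ k * cos (β k * π / 2)) (fourierB φ k * sin (β k * π / 2))
  have e2 := abs_add_le (fourierA φ k * sin (β k * π / 2)) (fourierB φ k * cos (β k * π / 2))
  linarith [h1 _ _ hA hc, h1 _ _ hA hs, h1 _ _ hB hc, h1 _ _ hB hs]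

theorem summable_integral_coeff {ψ : ℕ → ℝ} (hψ : ClassD0 ψ) (β : ℕ → ℝ) {s : ℝ≥0∞}
    (h1 : 1 ≤ s) (h2 : s < ∞) {φ : ℝ → ℝ} (hφ : MemLp φ s periodMeasure) :
    Summable fun i : ℕ => |integralA ψ β φ (i + 1)| + |integralB ψ β φ (i + 1)| := by
  have h := ((summable_nat_add_iff 1).mpr hψ.summable).mul_right (4 * (2 * lsNorm s φ))
  exact Summable.of_nonneg_of_le (fun i => by positivity) (fun i =>
    abs_integralA_add_abs_integralB_le (hψ.1 _ (by omega)).le (abs_fourierA_le h1 h2 hφ _)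
      (abs_fourierB_le h1 h2 hφ _)) h

theorem MemC.memLs_one {f : ℝ → ℝ} (hf : MemC f) : MemLs 1 f :=
  ⟨hf.2, memLp_one_iff_integrable.mpr hf.1.integrableOn_Ioc⟩

/-- Summability of `ψ` makes the series with the prescribed coefficients a continuous function;
undoing the rotation by `β_k π/2` recovers the coefficients of `φ`. -/
theorem exists_psiBetaIntegral {ψ : ℕ → ℝ} (hψ : ClassD0 ψ) (β : ℕ → ℝ) {s : ℝ≥0∞}
    (h1 : 1 ≤ s) (h2 : s < ∞) {φ : ℝ → ℝ} (hφ : MemLs s φ) (h0 : fourierA φ 0 = 0) :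
    ∃ F, MemCPsiBetaLs ψ β s F φ := by
  have hs := summable_integral_coeff hψ β h1 h2 hφ.2
  have hC := memC_harmonicSeries _ _ hs
  refine ⟨harmonicSeries (integralA ψ β φ) (integralB ψ β φ), hC,
    ⟨hC.memLs_one, ⟨hφ.1, hφ.2.mono_exponent h1⟩, h0, fun k hk => ?_, fun k hk => ?_⟩, hφ⟩
  all_goals
    rw [fourierA_harmonicSeries _ _ hs k hk, fourierB_harmonicSeries _ _ hs k hk, integralA,
      integralB]
    have h0 := (hψ.1 k hk).ne'
    field_simp
  · linear_combination (-fourierA φ k) * sin_sq_add_cos_sq (β k * π / 2)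
  · linear_combination (-fourierB φ k) * sin_sq_add_cos_sq (β k * π / 2)

/-! ### The asymptotic formula for the deviation -/

theorem hasSum_rhoTilde_fourierSeries {ψ β : ℕ → ℝ} (hψ : ClassD0 ψ) {s : ℝ≥0∞} (h1 : 1 ≤ s)
    (h2 : s < ∞) {n p : ℕ} (hn : 1 ≤ n) (hpn : p ≤ n) {f φ : ℝ → ℝ}
    (hf : MemCPsiBetaLs ψ β s f φ) (x : ℝ) :
    HasSum (fun i : ℕ => rhoTilde n p
      (harmonic (integralA ψ β φ (i + 1)) (integralB ψ β φ (i + 1)) (i + 1)) x)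
      (rhoTilde n p f x) := by
  obtain ⟨hC, hd, hφ⟩ := hf
  have hA : ∀ i : ℕ, fourierA f (i + 1) = integralA ψ β φ (i + 1) := fun i =>
    hd.fourierA_eq hψ (by omega)
  have hB : ∀ i : ℕ, fourierB f (i + 1) = integralB ψ β φ (i + 1) := fun i =>
    hd.fourierB_eq hψ (by omega)
  have h := hasSum_fourierSeries f hC
    (by simpa only [hA, hB] using summable_integral_coeff hψ β h1 h2 hφ.2)
  simp only [hA, hB] at h
  have h3 := hasSum_rhoTilde n p _ _ h x
  have h4 := rhoTilde_linear n p f (fun _ => 1) 1 (-(fourierA f 0 / 2)) x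
  rw [rhoTilde_one n p hn hpn] at h4
  simp only [one_mul, mul_one, mul_zero, add_zero, ← sub_eq_add_neg] at h4
  rwa [h4] at h3

/-- The subtracted integral is exactly the order `n - p + 1` contribution. Lower orders vanish and
higher ones are absorbed in the tail. -/
theorem abs_rhoTilde_sub_le {ψ β : ℕ → ℝ} (hψ : ClassD0 ψ) {s : ℝ≥0∞} (h1 : 1 ≤ s)
    (h2 : s < ∞) {n p : ℕ} (hp : 2 ≤ p) (hpn : p ≤ n) {f φ : ℝ → ℝ}
    (hf : MemCPsiBetaLs ψ β s f φ) (x : ℝ) :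
    |rhoTilde n p f x - ψ (n - p + 1) / (π * p) * ∫ t in (-π)..π, φ t *
        cos ((n - p + 1 : ℕ) * t + (β (n - p + 1) * π / 2 - (n - p + 1 : ℕ) * x))| ≤
      32 * (∑' i, tailTerm ψ n p i) * bestApprox (n - p + 1) s φ := by
  have hφ := hf.2.2.2
  have H := hasSum_rhoTilde_fourierSeries hψ h1 h2 (by omega) hpn hf x
  set u : ℕ → ℝ := fun i => rhoTilde n p
      (harmonic (integralA ψ β φ (i + 1)) (integralB ψ β φ (i + 1)) (i + 1)) x with hu
  set E := bestApprox (n - p + 1) s φ with hE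
  have hp0 : (p : ℝ) ≠ 0 := by
    have : p ≠ 0 := by omega
    exact_mod_cast this
  -- Index `i` carries frequency `i + 1`, so this range ends at frequency `n - p + 1`, the only one
  -- in it that is not annihilated.
  have hmain : ∑ i ∈ Finset.range (n - p + 1), u i = ψ (n - p + 1) / (π * p) *
      ∫ t in (-π)..π, φ t *
        cos ((n - p + 1 : ℕ) * t + (β (n - p + 1) * π / 2 - (n - p + 1 : ℕ) * x)) := by
    have hI := integral_mul_cos_add (intervalIntegrable_of_memLp h1 hφ) (n - p + 1)
      (β (n - p + 1) * π / 2 - (n - p + 1 : ℕ) * x)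
    have htau : tau n p (n - p + 1) = 1 / p := by
      rw [tau, if_pos (by omega)]
      push_cast [Nat.cast_sub hpn]
      field_simp
      ring
    have hzero : ∑ i ∈ Finset.range (n - p), u i = 0 := by
      refine Finset.sum_eq_zero fun i hi => ?_
      rw [Finset.mem_range] at hi
      simp only [hu]
      rw [rhoTilde_harmonic_of_lt n p hpn _ _ _ (by omega) (by omega),
        one_sub_lam_of_le n p _ (by omega), zero_mul]
    rw [Finset.sum_range_succ, hzero, zero_add]
    simp only [hu]
    rw [rhoTilde_harmonic_of_lt n p hpn _ _ _ (by omega) (by omega),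
      one_sub_lam_of_lt n p _ (by omega) (by omega) (by omega), htau, harmonic, integralA,
      integralB]
    have e : ∀ I : ℝ, ψ (n - p + 1) / (π * p) * I = ψ (n - p + 1) / p * (1 / π * I) := fun I => by
      field_simp
    rw [e, hI, cos_sub, sin_sub]
    ring
  have hsplit := (hasSum_nat_add_iff' (n - p + 1)).mpr H
  rw [hmain] at hsplit
  -- `32 = 4 · 4 · 2`: the deviation of a harmonic, the rotation of the coefficient pair, and the
  -- bound `2E` for each coefficient of `φ`.
  have hbound : ∀ i, ‖u (i + (n - p + 1))‖ ≤ 32 * E * tailTerm ψ n p i := by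
    intro i
    have hidx : n - p + 2 + i = i + (n - p + 1) + 1 := by omega
    have hψk := (hψ.1 (i + (n - p + 1) + 1) (by omega)).le
    have ht := tau_nonneg n p (i + (n - p + 1) + 1) (by omega) (by omega)
    have hb := abs_integralA_add_abs_integralB_le (β := β) hψk
      (abs_fourierA_le_bestApprox h1 h2 hφ (m := n - p + 1) (by omega) (by omega))
      (abs_fourierB_le_bestApprox h1 h2 hφ (m := n - p + 1) (by omega) (by omega))
    have hr := abs_rhoTilde_harmonic_le n p (by omega) hpn
      (integralA ψ β φ (i + (n - p + 1) + 1)) (integralB ψ β φ (i + (n - p + 1) + 1))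
      (i + (n - p + 1) + 1) (by omega) (by omega) x
    rw [tailTerm, hidx]
    refine hr.trans ?_
    refine (mul_le_mul_of_nonneg_left hb (by positivity)).trans (le_of_eq ?_)
    rw [← hE]
    ring
  have hfin := tsum_of_norm_bounded ((summable_tailTerm hψ (by omega)).hasSum.mul_left (32 * E))
    hbound
  rw [hsplit.tsum_eq, Real.norm_eq_abs] at hfin
  linarith

theorem abs_rhoTilde_le {ψ β : ℕ → ℝ} (hψ : ClassD0 ψ) {s : ℝ≥0∞} (h1 : 1 ≤ s)
    (h2 : s < ∞) {n p : ℕ} (hp : 2 ≤ p) (hpn : p ≤ n) {f φ : ℝ → ℝ}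
    (hf : MemCPsiBetaLs ψ β s f φ) (x : ℝ) :
    |rhoTilde n p f x| ≤ lebesgueFactor ψ s n p 32 * bestApprox (n - p + 1) s φ := by
  have h := abs_rhoTilde_sub_le hψ h1 h2 hp hpn hf x
  have hI := abs_integral_mul_cos_le_bestApprox h1 h2 hf.2.2.2 (m := n - p + 1) (by omega)
    (β (n - p + 1) * π / 2 - (n - p + 1 : ℕ) * x)
  set I := ∫ t in (-π)..π, φ t *
    cos ((n - p + 1 : ℕ) * t + (β (n - p + 1) * π / 2 - (n - p + 1 : ℕ) * x))
  have hψm := hψ.1 (n - p + 1) (by omega)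
  have hk : 0 ≤ ψ (n - p + 1) / (π * p) := by have := pi_pos; positivity
  have hM : |ψ (n - p + 1) / (π * p) * I| ≤
      ψ (n - p + 1) / (π * p) * (lsNorm (conjExp s) cos * bestApprox (n - p + 1) s φ) := by
    rw [abs_mul, abs_of_nonneg hk]
    exact mul_le_mul_of_nonneg_left hI hk
  have h3 := abs_sub_abs_le_abs_sub (rhoTilde n p f x) (ψ (n - p + 1) / (π * p) * I)
  have e : lebesgueFactor ψ s n p 32 * bestApprox (n - p + 1) s φ =
      ψ (n - p + 1) / (π * p) * (lsNorm (conjExp s) cos * bestApprox (n - p + 1) s φ) +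
      32 * (∑' i, tailTerm ψ n p i) * bestApprox (n - p + 1) s φ := by
    rw [lebesgueFactor]; ring
  rw [e]
  linarith

/-- Compressing `h` by `m` and shifting the phase preserves both `‖h‖_s` and the integral against
the cosine. Removing the mean changes neither that integral nor the best approximation (constants
are admissible as `m ≥ 1`), and scaling fixes the latter at `E`. -/
theorem exists_nearly_extremal_deriv {s : ℝ≥0∞} (h1 : 1 ≤ s) (h2 : s < ∞) {m : ℕ} (hm : 1 ≤ m)
    (c : ℝ) {ε : ℝ} (hε0 : 0 < ε) (hε1 : ε < 1) {E : ℝ} (hE : 0 ≤ E) :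
    ∃ Φ : ℝ → ℝ, MemLs s Φ ∧ fourierA Φ 0 = 0 ∧ bestApprox m s Φ = E ∧
      (1 - ε) * (lsNorm (conjExp s) cos * E) ≤ ∫ t in (-π)..π, Φ t * cos (m * t + c) := by
  obtain ⟨h, hmeas, ⟨B, hB⟩, hper, hpos, hle⟩ := exists_nearly_extremal_cos h1 h2 hε0 hε1
  have hB0 : 0 ≤ B := (abs_nonneg _).trans (hB 0)
  set Φ₀ : ℝ → ℝ := fun t => h (m * t + c) with hΦ₀
  have hmeas₀ : Measurable Φ₀ := hmeas.comp (by fun_prop)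
  have hB₀ : ∀ t, |Φ₀ t| ≤ B := fun t => hB _
  have hmem₀ : MemLp Φ₀ s periodMeasure := memLp_of_measurable_of_bound hmeas₀ hB₀ s
  have hii : IntervalIntegrable Φ₀ volume (-π) π :=
    intervalIntegrable_of_measurable_of_bound hmeas₀ hB₀ _ _
  have hper₀ : Function.Periodic Φ₀ (2 * π) := by
    intro t
    have := hper.nat_mul m (m * t + c)
    simp only [hΦ₀]
    rw [← this]
    congr 1; ring
  have hJ : ∫ t in (-π)..π, Φ₀ t * cos (m * t + c) = ∫ t in (-π)..π, h t * cos t := by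
    refine integral_comp_natMul_add (G := fun t => h t * cos t)
      (fun t => by simp only [hper t, cos_add_two_pi]) ?_ hm c
    refine intervalIntegrable_of_measurable_of_bound (B := B) (by fun_prop) fun t => ?_
    rw [abs_mul]
    exact (mul_le_of_le_one_right (abs_nonneg _) (abs_cos_le_one t)).trans (hB t)
  set J := ∫ t in (-π)..π, h t * cos t with hJdef
  have hnorm : lsNorm s Φ₀ = lsNorm s h :=
    lsNorm_comp_natMul_add (zero_lt_one.trans_le h1).ne' h2.ne hmeas hB hper hm c
  set E₀ := bestApprox m s Φ₀ with hE₀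
  have hN := lsNorm_nonneg (conjExp s) cos
  have hup := abs_integral_mul_cos_le_bestApprox h1 h2 hmem₀ hm c
  rw [hJ, abs_of_pos hpos, ← hE₀] at hup
  -- The upper estimate `J ≤ ‖cos‖_{s'} E₀` with `J > 0` permits division by `E₀`.
  have hE₀pos : 0 < E₀ := by
    by_contra! hcon
    linarith [mul_nonpos_of_nonneg_of_nonpos hN hcon]
  have hE₀le : E₀ ≤ lsNorm s h := hnorm ▸ bestApprox_le_lsNorm m s Φ₀
  set b := (1 / (2 * π)) * ∫ t in (-π)..π, Φ₀ t with hb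
  refine ⟨fun t => E / E₀ * (Φ₀ t - b), ⟨fun t => by simp only [hper₀ t], ?_⟩, ?_, ?_, ?_⟩
  · exact (hmem₀.sub (memLp_const b)).const_mul _
  · have hpi := pi_ne_zero
    simp only [fourierA, Nat.cast_zero, zero_mul, cos_zero, mul_one]
    rw [intervalIntegral.integral_const_mul, intervalIntegral.integral_sub hii
      intervalIntegrable_const, intervalIntegral.integral_const, hb, smul_eq_mul]
    field_simp
    ring
  · rw [bestApprox_mul_sub hm s Φ₀ (div_nonneg hE hE₀pos.le), ← hE₀, div_mul_cancel₀ _ hE₀pos.ne']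
  · have hcos0 : ∫ t in (-π)..π, cos (m * t + c) = 0 := by
      have := integral_comp_natMul_add cos_periodic
        (fun a b => continuous_cos.intervalIntegrable a b) hm c
      rw [this, integral_cos]
      simp
    have hint : ∫ t in (-π)..π, E / E₀ * (Φ₀ t - b) * cos (m * t + c) = E / E₀ * J := by
      have e : ∀ t, E / E₀ * (Φ₀ t - b) * cos (m * t + c) =
          E / E₀ * (Φ₀ t * cos (m * t + c) - b * cos (m * t + c)) := fun t => by ring
      simp only [e]
      rw [intervalIntegral.integral_const_mul, intervalIntegral.integral_sub
        (hii.mul_continuousOn (by fun_prop)) (Continuous.intervalIntegrable (by fun_prop) _ _),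
        intervalIntegral.integral_const_mul, hcos0, hJ]
      ring
    rw [hint, div_mul_eq_mul_div, le_div_iff₀ hE₀pos]
    have h3 : (1 - ε) * E₀ * lsNorm (conjExp s) cos ≤ J :=
      (mul_le_mul_of_nonneg_right (mul_le_mul_of_nonneg_left hE₀le (by linarith)) hN).trans hle
    have h4 := mul_le_mul_of_nonneg_left h3 hE
    linarith

/-! ### From two-sided bounds to `θ`, and attainment of the maximum. -/

theorem exists_theta_of_bounds {M W E y C : ℝ} (hW : 0 < W) (hE : 0 ≤ E) (hC : 0 ≤ C)
    (hlo : (M - C * W) * E ≤ y) (hup : y ≤ (M + C * W) * E) :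
    ∃ θ : ℝ, |θ| ≤ C ∧ y = (M + θ * W) * E := by
  rcases hE.eq_or_lt with rfl | hE
  · exact ⟨0, by simpa using hC, by linarith⟩
  · refine ⟨(y / E - M) / W, ?_, by field_simp; ring⟩
    rw [← le_div_iff₀ hE] at hlo
    rw [← div_le_iff₀ hE] at hup
    rw [abs_le, le_div_iff₀ hW, div_le_iff₀ hW]
    constructor <;> linarith

theorem exists_isGreatest_abs_rhoTilde (n p : ℕ) {f : ℝ → ℝ} (hf : MemC f) :
    ∃ x₁, IsGreatest (Set.range fun x => |rhoTilde n p f x|) |rhoTilde n p f x₁| := by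
  obtain ⟨x₁, -, hx₁⟩ := isCompact_Icc.exists_isMaxOn
    (Set.nonempty_Icc.mpr two_pi_pos.le) (continuous_rhoTilde n p f hf.1).abs.continuousOn
  refine ⟨x₁, ⟨x₁, rfl⟩, ?_⟩
  rintro _ ⟨x, rfl⟩
  obtain ⟨y, hy, hxy⟩ := (periodic_rhoTilde n p f hf.2).exists_mem_Ico₀ two_pi_pos x
  simp only [hxy]
  exact hx₁ ⟨hy.1, hy.2.le⟩

end ValleePoussin

end

/-- The constant `C` bounding the `O(1)` terms is absolute: it is chosen before `ψ`, `β`, `s`,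
`n`, `p`, `f` and `x`. -/
theorem mainTheorem3 :
    ∃ C : ℝ, 0 < C ∧
      ∀ (ψ β : ℕ → ℝ), ValleePoussin.ClassD0 ψ →
      ∀ (s : ℝ≥0∞), 1 ≤ s → s < ∞ →
      ∀ (n p : ℕ), 2 ≤ p → p ≤ n →
        Summable (ValleePoussin.tailTerm ψ n p) ∧
        ∀ (f φ : ℝ → ℝ), ValleePoussin.MemCPsiBetaLs ψ β s f φ →
          (∀ x : ℝ, |ValleePoussin.rhoTilde n p f x| ≤
            ValleePoussin.lebesgueFactor ψ s n p C *
              ValleePoussin.bestApprox (n - p + 1) s φ) ∧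
          (∀ x₀ : ℝ, ∃ F Φ : ℝ → ℝ,
            ValleePoussin.MemCPsiBetaLs ψ β s F Φ ∧
            ValleePoussin.bestApprox (n - p + 1) s Φ =
              ValleePoussin.bestApprox (n - p + 1) s φ ∧
            (∃ θ : ℝ, |θ| ≤ C ∧
              |ValleePoussin.rhoTilde n p F x₀| =
                ValleePoussin.lebesgueFactor ψ s n p θ *
                  ValleePoussin.bestApprox (n - p + 1) s Φ) ∧
            (∃ θ : ℝ, |θ| ≤ C ∧
              IsGreatest (Set.range fun x => |ValleePoussin.rhoTilde n p F x|)
                (ValleePoussin.lebesgueFactor ψ s n p θ *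
                  ValleePoussin.bestApprox (n - p + 1) s Φ))) := by
  open ValleePoussin in
  -- `33 = 32 + 1`: the tail estimate plus one more `W` for the loss from using only a nearly
  -- extremal function.
  refine ⟨33, by norm_num, fun ψ β hψ s h1 h2 n p hp hpn =>
    ⟨summable_tailTerm hψ (by omega), fun f φ hf => ?_⟩⟩
  have hW := tsum_tailTerm_pos hψ (n := n) (p := p) (by omega)
  have hE := bestApprox_nonneg (n - p + 1) s φ
  have hup : ∀ {g γ : ℝ → ℝ}, MemCPsiBetaLs ψ β s g γ → ∀ x, |rhoTilde n p g x| ≤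
      lebesgueFactor ψ s n p 33 * bestApprox (n - p + 1) s γ := fun hg x =>
    (abs_rhoTilde_le hψ h1 h2 hp hpn hg x).trans
      (mul_le_mul_of_nonneg_right (by rw [lebesgueFactor, lebesgueFactor]; linarith)
        (bestApprox_nonneg _ _ _))
  refine ⟨hup hf, fun x₀ => ?_⟩
  set W := ∑' i, tailTerm ψ n p i with hWdef
  set E := bestApprox (n - p + 1) s φ
  set M := lsNorm (conjExp s) cos / (π * p) * ψ (n - p + 1) with hM
  have hpi := pi_pos
  have hψm := hψ.1 (n - p + 1) (by omega)
  have hM0 : 0 ≤ M := by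
    have := lsNorm_nonneg (conjExp s) cos
    positivity
  -- The loss `ε M` in the main term must be at most `W`; `M + 1` avoids dividing by zero.
  set ε := min (1 / 2) (W / (M + 1)) with hε
  have hε0 : 0 < ε := lt_min (by norm_num) (by positivity)
  have hε1 : ε < 1 := (min_le_left _ _).trans_lt (by norm_num)
  have hεM : ε * M ≤ W := by
    have h3 : ε * (M + 1) ≤ W := by
      rw [← le_div_iff₀ (by linarith)]; exact min_le_right _ _
    linarith
  obtain ⟨Φ, hΦ, hΦ0, hΦE, hΦint⟩ := exists_nearly_extremal_deriv h1 h2 (m := n - p + 1) (by omega)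
    (β (n - p + 1) * π / 2 - (n - p + 1 : ℕ) * x₀) hε0 hε1 hE
  obtain ⟨F, hF⟩ := exists_psiBetaIntegral hψ β h1 h2 hΦ hΦ0
  have hlo : (M - 33 * W) * E ≤ |rhoTilde n p F x₀| := by
    have h3 := abs_rhoTilde_sub_le hψ h1 h2 hp hpn hF x₀
    rw [hΦE] at h3
    have hk : 0 ≤ ψ (n - p + 1) / (π * p) := by positivity
    have h4 := mul_le_mul_of_nonneg_left hΦint hk
    have h5 : ψ (n - p + 1) / (π * p) * ((1 - ε) * (lsNorm (conjExp s) cos * E)) =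
        (1 - ε) * M * E := by rw [hM]; ring
    have h6 := mul_le_mul_of_nonneg_right hεM hE
    have h7 := (abs_le.mp h3).1
    have h8 := le_abs_self (rhoTilde n p F x₀)
    rw [h5] at h4
    linarith
  have hupF : ∀ x, |rhoTilde n p F x| ≤ (M + 33 * W) * E := fun x => hΦE ▸ hup hF x
  obtain ⟨x₁, hx₁⟩ := exists_isGreatest_abs_rhoTilde n p hF.1
  obtain ⟨θ, hθ, hθe⟩ := exists_theta_of_bounds hW hE (by norm_num) hlo (hupF x₀)
  -- The maximum is at least the value at `x₀`, so the same `F` inherits the lower bound.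
  obtain ⟨θ', hθ', hθe'⟩ := exists_theta_of_bounds hW hE (by norm_num)
    (hlo.trans (hx₁.2 ⟨x₀, rfl⟩)) (hupF x₁)
  refine ⟨F, Φ, hF, hΦE, ⟨θ, hθ, ?_⟩, ⟨θ', hθ', ?_⟩⟩
  · rw [hΦE]; exact hθe
  · rw [hΦE]
    rw [hθe'] at hx₁
    exact hx₁
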